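/- Let $K$ be a field and let $\mathcal C$ be an additive $K$-category. Write $\operatorname{Mod}(\mathcal C)$ for the abelian category of ($K$-linear) functors $\mathcal C^{\mathrm{op}}\to \operatorname{Mod} K$. Let $\operatorname{rad}_{\mathcal C}$ be the radical of $\mathcal C$ ($f\colon X\to Y$ lies in it iff $gf\in\operatorname{rad}\operatorname{End}_{\mathcal C}(X)$ for all $g\colon Y\to X$), let $\operatorname{rad}^i_{\mathcal C}$ be its powers as an ideal (with $\operatorname{rad}^0_{\mathcal C}=\operatorname{Hom}_{\mathcal C}$), and for $F\in\operatorname{Mod}(\mathcal C)$ put $(\operatorname{rad}^i_{\mathcal C}F)(X)=\sum_{Y,\,f\in\operatorname{rad}^i_{\mathcal C}(X,Y)}\operatorname{Im}F(f)$. A functor $F$ in $\operatorname{Mod}(\mathcal C)$ is *weakly Koszul* if it has a resolution $\cdots\to P_1\to P_0\to F\to 0$ by finitely generated projective objects such that, with $\Omega^{j+1}(F)=\operatorname{Im}(P_{j+1}\to P_j)$, one has $\operatorname{rad}^{i+1}_{\mathcal C}(P_j)\cap\Omega^{j+1}(F)=\operatorname{rad}^i_{\mathcal C}(\Omega^{j+1}(F))$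 for all $j\ge 0$ and $i\ge 1$. The category $\mathcal C$ is *weakly Koszul* if every object of $\mathcal C$ is a finite direct sum of objects with local endomorphism rings (Krull-Schmidt), $\operatorname{rad}^i_{\mathcal C}(X,Y)/\operatorname{rad}^{i+1}_{\mathcal C}(X,Y)$ is finite dimensional over $K$ for all $X,Y$ and all $i\ge 0$, and every simple functor in $\operatorname{Mod}(\mathcal C)$ is weakly Koszul. Let $\mathcal S(\mathcal C)$ be the full subcategory of $\operatorname{Mod}(\mathcal C)$ of finite direct sums of simple functors, and let $E(\mathcal S(\mathcal C))$ be the graded $K$-category with the same objects, with $\operatorname{Hom}(A,B)=\bigoplus_{i\ge 0}\operatorname{Ext}^i_{\operatorname{Mod}(\mathcal C)}(A,B)$, where $\operatorname{Ext}^i$ is the part of degree $i$, and with the Yoneda product as composition. For a graded $K$-category $\mathcal D$ let $\operatorname{Gr}(\mathcal D)$ be the category of graded functors $F$ from $\mathcal D^{\mathrm{op}}$ to $\mathbb Z$-graded $K$-vector spaces, with $\operatorname{Hom}(F,G)=\bigoplus_{i\in\mathbb Z}\operatorname{Hom}_0(F,G[i])$, where $\operatorname{Hom}_0$ denotes the natural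 transformations of degree zero and $G[i]_j=G_{i+j}$. When $\mathcal D$ is additive, positively graded, (graded) Krull-Schmidt and locally finite, $F$ in $\operatorname{Gr}(\mathcal D)$ is *linear* if there is an exact sequence $$\cdots\to\operatorname{Hom}_{\mathcal D}(-,D_2)[-2]\to\operatorname{Hom}_{\mathcal D}(-,D_1)[-1]\to\operatorname{Hom}_{\mathcal D}(-,D_0)\to F\to 0$$ with $D_i\in\mathcal D$ and all morphisms of degree zero. **Proposition.** Let $\mathcal C$ be a weakly Koszul $K$-category. Then $E(\mathcal S(\mathcal C))^{\mathrm{op}}$ is an additive, positively graded, Krull-Schmidt, locally finite $K$-category, and the contravariant functor $$\phi\colon\operatorname{Mod}(\mathcal C)\to\operatorname{Gr}\bigl(E(\mathcal S(\mathcal C))^{\mathrm{op}}\bigr),\qquad \phi(F)=\operatorname{Ext}^*_{\operatorname{Mod}(\mathcal C)}(F,-)=\bigoplus_{i\ge 0}\operatorname{Ext}^i_{\operatorname{Mod}(\mathcal C)}(F,-),$$ restricts to a functor from the full subcategory of weakly Koszul functors in $\operatorname{Mod}(\mathcal C)$ to the full subcategory of linear functors in $\operatorname{Gr}(E(\mathcal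 S(\mathcal C))^{\mathrm{op}})$. -/

import Mathlib

open CategoryTheory CategoryTheory.Limits Opposite

universe w v u t

namespace KoszulCat

section LinearFunctors

variable (K : Type t) [Field K]

/-- The opposite of a `K`-linear category is `K`-linear. -/
instance linearOpposite (C : Type u) [Category.{v} C] [Preadditive C] [Linear K C] :
    Linear K Cᵒᵖ where
  homModule _ _ :=
    { smul := fun r f => (r • f.unop).op
      one_smul := fun f => Quiver.Hom.unop_inj (one_smul K f.unop)
      mul_smul := fun r s f => Quiver.Hom.unop_inj (mul_smul r s f.unop)
      smul_zero := fun r => Quiver.Hom.unop_inj (smul_zero r)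
      smul_add := fun r f g => Quiver.Hom.unop_inj (smul_add r f.unop g.unop)
      add_smul := fun r s f => Quiver.Hom.unop_inj (add_smul r s f.unop)
      zero_smul := fun f => Quiver.Hom.unop_inj (zero_smul K f.unop) }
  smul_comp _ _ _ r f g := Quiver.Hom.unop_inj (Linear.comp_smul _ _ _ g.unop r f.unop)
  comp_smul _ _ _ f r g := Quiver.Hom.unop_inj (Linear.smul_comp _ _ _ r g.unop f.unop)

variable (C : Type u) [Category.{v} C] [Preadditive C] [Linear K C]

/-- The property of a functor `Cᵒᵖ ⥤ ModuleCat K` of being `K`-linear (in particular additive). -/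
def isLinearFunctor : ObjectProperty (Cᵒᵖ ⥤ ModuleCat.{w} K) :=
  fun F => F.Additive ∧ F.Linear K

/-- `Mod(C)`: the category of contravariant `K`-linear functors from the `K`-category `C` to the
category of `K`-vector spaces, with all natural transformations. -/
abbrev FunctorMod : Type (max u v t (w + 1)) :=
  (isLinearFunctor.{w} K C).FullSubcategory

variable {K C}

lemma isLinearFunctor_of_jointly_mono {F : Cᵒᵖ ⥤ ModuleCat.{w} K} {J : Type*}
    (G : J → Cᵒᵖ ⥤ ModuleCat.{w} K) (p : ∀ j, F ⟶ G j)
    (hp : ∀ (X : Cᵒᵖ) (M : ModuleCat.{w} K) (a b : M ⟶ F.obj X),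
      (∀ j, a ≫ (p j).app X = b ≫ (p j).app X) → a = b)
    (hG : ∀ j, isLinearFunctor K C (G j)) : isLinearFunctor K C F := by
  refine ⟨⟨fun {X Y f g} => hp _ _ _ _ fun j => ?_⟩, ⟨fun {X Y} f r => hp _ _ _ _ fun j => ?_⟩⟩
  · have := (hG j).1
    rw [(p j).naturality, Functor.map_add, Preadditive.comp_add, Preadditive.add_comp,
      (p j).naturality, (p j).naturality]
  · have := (hG j).1
    have := (hG j).2
    rw [(p j).naturality, Functor.map_smul, Linear.comp_smul, Linear.smul_comp,
      (p j).naturality]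

lemma isLinearFunctor_of_epi {F G : Cᵒᵖ ⥤ ModuleCat.{w} K} (p : F ⟶ G) [Epi p]
    (hF : isLinearFunctor K C F) : isLinearFunctor K C G := by
  have := hF.1
  have := hF.2
  refine ⟨⟨fun {X Y f g} => ?_⟩, ⟨fun {X Y} f r => ?_⟩⟩
  · rw [← cancel_epi (p.app X), ← p.naturality, Functor.map_add, Preadditive.comp_add,
      Preadditive.add_comp, p.naturality, p.naturality]
  · rw [← cancel_epi (p.app X), ← p.naturality, Functor.map_smul, Linear.comp_smul,
      Linear.smul_comp, p.naturality]

instance : (isLinearFunctor.{w} K C).IsClosedUnderSubobjects where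
  prop_of_mono {F G} f _ hG :=
    isLinearFunctor_of_jointly_mono (J := Unit) (fun _ => G) (fun _ => f)
      (fun X M a b h => by rw [← cancel_mono (f.app X)]; exact h ()) (fun _ => hG)

instance : (isLinearFunctor.{w} K C).IsClosedUnderQuotients where
  prop_of_epi f _ hF := isLinearFunctor_of_epi f hF

instance : (isLinearFunctor.{w} K C).IsClosedUnderFiniteProducts where
  isClosedUnderLimitsOfShape J _ := by
    refine ⟨?_⟩
    rintro F ⟨h⟩
    exact isLinearFunctor_of_jointly_mono (fun j => h.diag.obj j) (fun j => h.π.app j)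
      (fun X M a b hab =>
        (isLimitOfPreserves ((evaluation _ _).obj X) h.isLimit).hom_ext fun j => hab j)
      (fun j => h.prop_diag_obj j)

instance : (isLinearFunctor.{w} K C).ContainsZero where
  exists_zero := by
    refine ⟨_, isZero_zero _, isLinearFunctor_of_jointly_mono (J := Empty) (fun j => j.elim)
      (fun j => j.elim) (fun X M a b _ => ?_) (fun j => j.elim)⟩
    exact ((isZero_zero (Cᵒᵖ ⥤ ModuleCat.{w} K)).obj X).eq_of_tgt a b

noncomputable instance : Abelian (FunctorMod.{w} K C) := inferInstance

instance : HasFiniteBiproducts (FunctorMod.{w} K C) := Abelian.hasFiniteBiproducts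

/-- The smallness condition `HasExt`, which says only that the groups `Ext^n` may be taken in a
given universe, is always satisfied for a large enough universe. -/
lemma hasExt_functorMod : HasExt.{max u v t (w + 1)} (FunctorMod.{w} K C) := HasExt.standard _

variable (K)

/-- The representable functor `Hom_C(-, X)`, as an object of `Mod(C)`. -/
def representable (X : C) : FunctorMod.{v} K C :=
  ⟨(linearYoneda K C).obj X, inferInstance,
    ⟨fun {_ _} f r => by ext g; exact Linear.smul_comp _ _ _ r f.unop g⟩⟩

variable {K}

/-- A functor in `Mod(C)` is finitely generated if it is a quotient of a representable functor. -/
def IsFinitelyGenerated (F : FunctorMod.{v} K C) : Prop :=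
  ∃ (X : C) (p : representable K X ⟶ F), Epi p

/-- The component `F(X) → G(X)` of a morphism `η : F ⟶ G` of `Mod(C)`. -/
def component {F G : FunctorMod.{w} K C} (η : F ⟶ G) (X : C) :
    F.obj.obj (op X) →ₗ[K] G.obj.obj (op X) :=
  (η.hom.app (op X)).hom

/-- The linear map `F(f) : F(Y) → F(X)` for `f : X ⟶ Y` and `F` in `Mod(C)`. -/
def action (F : FunctorMod.{w} K C) {X Y : C} (f : X ⟶ Y) :
    F.obj.obj (op Y) →ₗ[K] F.obj.obj (op X) :=
  (F.obj.map f.op).hom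

end LinearFunctors

section Radical

variable (K : Type t) [Field K] {C : Type u} [Category.{v} C] [Preadditive C] [Linear K C]

/-- The radical of `C`: a morphism `f : X ⟶ Y` is in the radical if for all `g : Y ⟶ X` the
endomorphism `f ≫ g` is in the Jacobson radical of the ring `End X`. -/
def radical (X Y : C) : Submodule K (X ⟶ Y) where
  carrier := {f | ∀ g : Y ⟶ X, End.of (f ≫ g) ∈ Ring.jacobson (End X)}
  zero_mem' g := by
    have : End.of ((0 : X ⟶ Y) ≫ g) = 0 := zero_comp
    rw [this]
    exact zero_mem _
  add_mem' {a b} ha hb g := by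
    have : End.of ((a + b) ≫ g) = End.of (a ≫ g) + End.of (b ≫ g) := Preadditive.add_comp _ _ _ _ _ _
    rw [this]
    exact add_mem (ha g) (hb g)
  smul_mem' r f hf g := by
    have : End.of ((r • f) ≫ g) = (algebraMap K (End X) r) * End.of (f ≫ g) := by
      rw [← Algebra.smul_def]
      exact Linear.smul_comp _ _ _ _ _ _
    rw [this]
    exact Ideal.mul_mem_left _ _ (hf g)

/-- The powers of the radical as an ideal of the category `C`: `rad⁰ = Hom`, and `radⁿ⁺¹(X, Y)`
consists of the finite sums of compositions of a morphism in `radⁿ(X, A)` followed by a morphism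
in `rad(A, Y)`. -/
def radicalPow : ℕ → ∀ X Y : C, Submodule K (X ⟶ Y)
  | 0, _, _ => ⊤
  | n + 1, X, Y => Submodule.span K
      {f | ∃ (A : C) (g : X ⟶ A) (h : A ⟶ Y), g ∈ radicalPow n X A ∧ h ∈ radical K A Y ∧ g ≫ h = f}

variable {K}

/-- Given a family `U` of subspaces `U(X) ⊆ F(X)` which forms a subfunctor of `F`, this is the
subfunctor `radⁿ U` of `F`: its value at `X` is the sum over all `f : X ⟶ Y` in `radⁿ(X, Y)` of
the images of `U(Y)` under `F(f)`. -/
def radicalSub (F : FunctorMod.{v} K C) (U : ∀ X : C, Submodule K (F.obj.obj (op X))) (n : ℕ)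
    (X : C) : Submodule K (F.obj.obj (op X)) :=
  ⨆ (Y : C) (f : radicalPow K n X Y), (U Y).map (action F f.1)

/-- A functor `F` in `Mod(C)` is weakly Koszul if it has a resolution
`⋯ ⟶ P 1 ⟶ P 0 ⟶ F ⟶ 0` by finitely generated projective objects of `Mod(C)` such that
`radⁱ⁺¹(P j) ∩ Ωʲ⁺¹(F) = radⁱ(Ωʲ⁺¹(F))` for all `j ≥ 0` and `i ≥ 1`, where the syzygy
`Ωʲ⁺¹(F) ⊆ P j` is the image of `P (j + 1) ⟶ P j`. -/
def IsWeaklyKoszul (F : FunctorMod.{v} K C) : Prop :=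
  ∃ (P : ℕ → FunctorMod.{v} K C) (d : ∀ n, P (n + 1) ⟶ P n) (ε : P 0 ⟶ F),
    (∀ n, Projective (P n) ∧ IsFinitelyGenerated (P n)) ∧
    (∀ X : C, Function.Surjective (component ε X)) ∧
    (∀ X : C, Function.Exact (component (d 0) X) (component ε X)) ∧
    (∀ (n : ℕ) (X : C), Function.Exact (component (d (n + 1)) X) (component (d n) X)) ∧
    (∀ (j i : ℕ), 1 ≤ i → ∀ X : C,
      radicalSub (P j) (fun _ => ⊤) (i + 1) X ⊓ LinearMap.range (component (d j) X) =
        radicalSub (P j) (fun Y => LinearMap.range (component (d j) Y)) i X)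

variable (K C)

/-- A `K`-category is locally radical finite if all the spaces `radⁱ(X, Y) / radⁱ⁺¹(X, Y)` are
finite dimensional. -/
def IsLocallyRadicalFinite : Prop :=
  ∀ (X Y : C) (i : ℕ), Module.Finite K
    (radicalPow K i X Y ⧸ (radicalPow K (i + 1) X Y).submoduleOf (radicalPow K i X Y))

/-- An additive category is Krull-Schmidt if every object is a finite direct sum of objects with
local endomorphism rings. -/
def IsKrullSchmidt (D : Type u) [Category.{v} D] [Preadditive D] [HasFiniteBiproducts D] : Prop :=
  ∀ X : D, ∃ (n : ℕ) (Y : Fin n → D), (∀ i, IsLocalRing (End (Y i))) ∧ Nonempty (X ≅ ⨁ Y)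

/-- A weakly Koszul `K`-category: an additive Krull-Schmidt locally radical finite `K`-category
such that every simple functor in `Mod(C)` is weakly Koszul. -/
structure IsWeaklyKoszulCategory [HasFiniteBiproducts C] : Prop where
  krullSchmidt : IsKrullSchmidt C
  locallyRadicalFinite : IsLocallyRadicalFinite K C
  simple_isWeaklyKoszul : ∀ S : FunctorMod.{v} K C, Simple S → IsWeaklyKoszul S

end Radical

section Graded

variable (K : Type t) [Field K]

/-- A `ℤ`-grading on a `K`-category `D`: each `Hom(X, Y)` is the direct sum of subspaces
`Hom(X, Y)_i`, `i ∈ ℤ`, and composition is additive on degrees. -/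
class GradedCategory (D : Type u) [Category.{v} D] [Preadditive D] [Linear K D] where
  /-- The morphisms of degree `i`. -/
  homDeg : ∀ X Y : D, ℤ → Submodule K (X ⟶ Y)
  isInternal : ∀ X Y : D, DirectSum.IsInternal (homDeg X Y)
  comp_mem : ∀ {X Y Z : D} {f : X ⟶ Y} {g : Y ⟶ Z} {i j : ℤ},
    f ∈ homDeg X Y i → g ∈ homDeg Y Z j → f ≫ g ∈ homDeg X Z (i + j)

lemma isInternal_map {M N : Type*} [AddCommGroup M] [Module K M] [AddCommGroup N] [Module K N]
    (e : M ≃ₗ[K] N) {A : ℤ → Submodule K M} (hA : DirectSum.IsInternal A)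
    {B : ℤ → Submodule K N} (hB : ∀ i, B i = (A i).map e.toLinearMap) :
    DirectSum.IsInternal B := by
  obtain rfl : B = fun i => (A i).map e.toLinearMap := funext hB
  rw [DirectSum.isInternal_submodule_iff_iSupIndep_and_iSup_eq_top] at hA ⊢
  refine ⟨hA.1.map_orderIso (Submodule.orderIsoMapComap e), ?_⟩
  rw [← Submodule.map_iSup, hA.2, Submodule.map_top]
  exact LinearMap.range_eq_top.2 e.surjective

/-- A direct sum `⨁ n : ℕ, M n` seen as a `ℤ`-graded space: the degree `i` part consists of the
elements with all components outside degree `i` equal to zero. -/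
def natDeg (M : ℕ → Type w) [∀ n, AddCommGroup (M n)] [∀ n, Module K (M n)] (i : ℤ) :
    Submodule K (DirectSum ℕ M) where
  carrier := {x | ∀ n : ℕ, (n : ℤ) ≠ i → x n = 0}
  zero_mem' _ _ := rfl
  add_mem' {a b} ha hb n hn := by rw [DirectSum.add_apply, ha n hn, hb n hn, add_zero]
  smul_mem' r a ha n hn := by rw [DirectSum.smul_apply, ha n hn, smul_zero]

lemma of_mem_natDeg (M : ℕ → Type w) [∀ n, AddCommGroup (M n)] [∀ n, Module K (M n)]
    (n : ℕ) (x : M n) : DirectSum.of M n x ∈ natDeg K M n := by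
  intro m hm
  exact DirectSum.of_eq_of_ne _ _ _ (fun h => hm (by rw [h]))

lemma exists_of_mem_natDeg (M : ℕ → Type w) [∀ n, AddCommGroup (M n)] [∀ n, Module K (M n)]
    {i : ℤ} {x : DirectSum ℕ M} (hx : x ∈ natDeg K M i) :
    x = 0 ∨ ∃ (n : ℕ) (y : M n), (n : ℤ) = i ∧ x = DirectSum.of M n y := by
  by_cases h : ∃ n : ℕ, (n : ℤ) = i
  · obtain ⟨n, rfl⟩ := h
    refine Or.inr ⟨n, x n, rfl, DFinsupp.ext fun m => ?_⟩
    by_cases hm : m = n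
    · subst hm
      exact (DirectSum.of_eq_same m (x m)).symm
    · rw [hx m (by exact_mod_cast hm)]
      exact (DirectSum.of_eq_of_ne _ _ _ hm).symm
  · exact Or.inl (DFinsupp.ext fun m => hx m fun hm => h ⟨m, hm⟩)

lemma natDeg_isInternal (M : ℕ → Type w) [∀ n, AddCommGroup (M n)] [∀ n, Module K (M n)] :
    DirectSum.IsInternal (natDeg K M) := by
  rw [DirectSum.isInternal_submodule_iff_iSupIndep_and_iSup_eq_top]
  refine ⟨?_, ?_⟩
  · intro i
    rw [Submodule.disjoint_def]
    intro x hx hx'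
    have hle : (⨆ (j : ℤ) (_ : j ≠ i), natDeg K M j) ≤
        ({ carrier := {x | ∀ n : ℕ, (n : ℤ) = i → x n = 0}
           zero_mem' := fun _ _ => rfl
           add_mem' := fun {a b} ha hb n hn => by
             rw [DirectSum.add_apply, ha n hn, hb n hn, add_zero]
           smul_mem' := fun r a ha n hn => by
             rw [DirectSum.smul_apply, ha n hn, smul_zero] } :
          Submodule K (DirectSum ℕ M)) := by
      refine iSup₂_le fun j hj y hy n hn => hy n ?_
      rw [hn]
      exact hj.symm
    refine DFinsupp.ext fun n => ?_
    by_cases hn : (n : ℤ) = i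
    · exact hle hx' n hn
    · exact hx n hn
  · rw [eq_top_iff]
    intro x _
    induction x using DirectSum.induction_on with
    | zero => exact zero_mem _
    | of n y => exact (le_iSup (natDeg K M) (n : ℤ)) (of_mem_natDeg K M n y)
    | add a b ha hb => exact add_mem (ha trivial) (hb trivial)

section

variable (D : Type u) [Category.{v} D] [Preadditive D] [Linear K D]

/-- The `K`-linear bijection between morphisms of `D` and of its opposite. -/
def opLinearEquiv (X Y : D) : (X ⟶ Y) ≃ₗ[K] (op Y ⟶ op X) where
  toFun f := f.op
  invFun f := f.unop
  map_add' _ _ := rfl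
  map_smul' _ _ := rfl

variable [GradedCategory K D]

/-- The opposite of a graded category, with the same degrees. -/
instance : GradedCategory K Dᵒᵖ where
  homDeg X Y i := (GradedCategory.homDeg Y.unop X.unop i).map
    (opLinearEquiv K D Y.unop X.unop).toLinearMap
  isInternal X Y := isInternal_map K (opLinearEquiv K D Y.unop X.unop)
    (GradedCategory.isInternal Y.unop X.unop) (fun _ => rfl)
  comp_mem := by
    rintro X Y Z _ _ i j ⟨f, hf, rfl⟩ ⟨g, hg, rfl⟩
    exact ⟨g ≫ f, add_comm j i ▸ GradedCategory.comp_mem hg hf, rfl⟩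

/-- A graded category is positively graded if all morphisms of negative degree are zero. -/
def IsPositivelyGraded : Prop :=
  ∀ (X Y : D) (i : ℤ), i < 0 → GradedCategory.homDeg (K := K) X Y i = ⊥

/-- A graded category is locally finite if the morphisms of each degree between any two objects
form a finite dimensional space. -/
def IsLocallyFinite : Prop :=
  ∀ (X Y : D) (i : ℤ), Module.Finite K (GradedCategory.homDeg (K := K) X Y i)

/-- The endomorphism ring of `X` is graded local: it is nonzero, and if the sum of two elements of
degree zero is the identity, then one of them is invertible. -/
def HasGradedLocalEnd {D : Type u} [Category.{v} D] [Preadditive D] [Linear K D]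
    [GradedCategory K D] (X : D) : Prop :=
  𝟙 X ≠ 0 ∧ ∀ a b : X ⟶ X, a ∈ GradedCategory.homDeg (K := K) X X 0 →
    b ∈ GradedCategory.homDeg (K := K) X X 0 → a + b = 𝟙 X → IsIso a ∨ IsIso b

/-- A graded category is (graded) Krull-Schmidt if every object is a finite direct sum, with
structure morphisms `ι i` and `π i` of degree zero, of objects with graded local endomorphism
rings. -/
def IsGradedKrullSchmidt : Prop :=
  ∀ X : D, ∃ (n : ℕ) (Y : Fin n → D) (ι : ∀ i, Y i ⟶ X) (π : ∀ i, X ⟶ Y i),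
    (∀ i, HasGradedLocalEnd K (Y i)) ∧
    (∀ i, ι i ∈ GradedCategory.homDeg (K := K) (Y i) X 0) ∧
    (∀ i, π i ∈ GradedCategory.homDeg (K := K) X (Y i) 0) ∧
    (∀ i, ι i ≫ π i = 𝟙 (Y i)) ∧ (∀ i j, i ≠ j → ι i ≫ π j = 0) ∧
    ∑ i, π i ≫ ι i = 𝟙 X

/-- A graded functor from `Dᵒᵖ` to `ℤ`-graded vector spaces: a `K`-linear functor `F` from `Dᵒᵖ` to
vector spaces together with a decomposition of each `F(X)` as a direct sum of subspaces `F(X)_j`,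
`j ∈ ℤ`, such that a morphism `f : X ⟶ Y` of degree `i` maps `F(Y)_j` into `F(X)_{i+j}`. -/
structure GradedFunctor where
  /-- The underlying functor. -/
  toFunctorMod : FunctorMod.{w} K D
  /-- The part of degree `j` of the value at `X`. -/
  deg : ∀ X : D, ℤ → Submodule K (toFunctorMod.obj.obj (op X))
  isInternal : ∀ X : D, DirectSum.IsInternal (deg X)
  action_mem : ∀ {X Y : D} {f : X ⟶ Y} {i j : ℤ} {x : toFunctorMod.obj.obj (op Y)},
    f ∈ GradedCategory.homDeg (K := K) X Y i → x ∈ deg Y j → action toFunctorMod f x ∈ deg X (i + j)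

end

namespace GradedFunctor

variable {K} {D : Type u} [Category.{v} D] [Preadditive D] [Linear K D] [GradedCategory K D]

/-- The natural transformations `F → G` which are homogeneous of degree `i`, that is, which map
`F(X)_j` into `G(X)_{i+j}`; in other words, the degree zero morphisms from `F` to `G[i]`. -/
def homDeg (F G : GradedFunctor.{w} K D) (i : ℤ) :
    Submodule K (F.toFunctorMod ⟶ G.toFunctorMod) where
  carrier := {η | ∀ (X : D) (j : ℤ), ∀ x ∈ F.deg X j, component η X x ∈ G.deg X (i + j)}
  zero_mem' _ _ _ _ := zero_mem _
  add_mem' {_ _} ha hb X j x hx := add_mem (ha X j x hx) (hb X j x hx)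
  smul_mem' r _ ha X j x hx := Submodule.smul_mem _ r (ha X j x hx)

lemma id_mem_homDeg (F : GradedFunctor.{w} K D) : 𝟙 F.toFunctorMod ∈ homDeg F F 0 := by
  intro X j x hx
  rw [zero_add]
  exact hx

lemma comp_mem_homDeg {F G H : GradedFunctor.{w} K D} {η : F.toFunctorMod ⟶ G.toFunctorMod}
    {θ : G.toFunctorMod ⟶ H.toFunctorMod} {i j : ℤ} (hη : η ∈ homDeg F G i)
    (hθ : θ ∈ homDeg G H j) : η ≫ θ ∈ homDeg F H (i + j) := by
  intro X k x hx
  have := hθ X _ _ (hη X k x hx)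
  rwa [← add_assoc, add_comm j i] at this

/-- A morphism in the category `Gr(D)` is a finite sum of homogeneous natural transformations. -/
@[ext]
structure Hom (F G : GradedFunctor.{w} K D) where
  /-- The underlying natural transformation. -/
  toHom : F.toFunctorMod ⟶ G.toFunctorMod
  mem : toHom ∈ ⨆ i, homDeg F G i

lemma comp_mem_iSup {F G H : GradedFunctor.{w} K D} {η : F.toFunctorMod ⟶ G.toFunctorMod}
    {θ : G.toFunctorMod ⟶ H.toFunctorMod} (hη : η ∈ ⨆ i, homDeg F G i)
    (hθ : θ ∈ ⨆ i, homDeg G H i) : η ≫ θ ∈ ⨆ i, homDeg F H i := by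
  induction hη using Submodule.iSup_induction' with
  | mem i η hη =>
    induction hθ using Submodule.iSup_induction' with
    | mem j θ hθ => exact Submodule.mem_iSup_of_mem (i + j) (comp_mem_homDeg hη hθ)
    | zero => rw [comp_zero]; exact zero_mem _
    | add a b _ _ ha hb => rw [Preadditive.comp_add]; exact add_mem ha hb
  | zero => rw [zero_comp]; exact zero_mem _
  | add a b _ _ ha hb => rw [Preadditive.add_comp]; exact add_mem ha hb

/-- The category `Gr(D)` of graded functors, whose morphism spaces are the direct sums over
`i ∈ ℤ` of the spaces of degree zero morphisms `F → G[i]`. The homogeneous parts of a natural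
transformation are determined by it (see `iSupIndep_homDeg`), so that this direct sum is realized
as a space of natural transformations. -/
instance : Category (GradedFunctor.{w} K D) where
  Hom F G := Hom F G
  id F := ⟨𝟙 _, Submodule.mem_iSup_of_mem 0 (id_mem_homDeg F)⟩
  comp f g := ⟨f.toHom ≫ g.toHom, comp_mem_iSup f.mem g.mem⟩
  id_comp f := Hom.ext (Category.id_comp f.toHom)
  comp_id f := Hom.ext (Category.comp_id f.toHom)
  assoc f g h := Hom.ext (Category.assoc f.toHom g.toHom h.toHom)

lemma iSupIndep_homDeg (F G : GradedFunctor.{w} K D) : iSupIndep (homDeg F G) := by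
  rw [iSupIndep_def]
  intro i
  rw [Submodule.disjoint_def]
  intro η hη hη'
  have key : ∀ (θ : F.toFunctorMod ⟶ G.toFunctorMod), θ ∈ (⨆ (k : ℤ) (_ : k ≠ i), homDeg F G k) →
      ∀ (X : D) (j : ℤ), ∀ x ∈ F.deg X j,
        component θ X x ∈ ⨆ (k : ℤ) (_ : k ≠ i + j), G.deg X k := by
    intro θ hθ X j x hx
    rw [iSup_subtype'] at hθ
    induction hθ using Submodule.iSup_induction' with
    | mem k θ hθ =>
      exact Submodule.mem_iSup_of_mem (k.1 + j) (Submodule.mem_iSup_of_mem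
        (fun h => k.2 (add_right_cancel h)) (hθ X j x hx))
    | zero => exact zero_mem _
    | add a b _ _ ha hb => exact add_mem ha hb
  have hzero : ∀ (X : D) (x : F.toFunctorMod.obj.obj (op X)), component η X x = 0 := by
    intro X x
    have hx : x ∈ ⨆ j, F.deg X j := by
      rw [((DirectSum.isInternal_submodule_iff_iSupIndep_and_iSup_eq_top _).1
        (F.isInternal X)).2]
      trivial
    induction hx using Submodule.iSup_induction' with
    | mem j x hx =>
      exact Submodule.disjoint_def.1 (((DirectSum.isInternal_submodule_iff_iSupIndep_and_iSup_eq_top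
        _).1 (G.isInternal X)).1 (i + j)) _ (hη X j x hx) (key η hη' X j x hx)
    | zero => exact map_zero _
    | add a b _ _ ha hb => rw [map_add, ha, hb, add_zero]
  ext X x
  exact hzero X.unop x

/-- The shift `F[m]` of a graded functor, `F[m](X)_j = F(X)_{m+j}`. -/
def shift (F : GradedFunctor.{w} K D) (m : ℤ) : GradedFunctor.{w} K D where
  toFunctorMod := F.toFunctorMod
  deg X j := F.deg X (m + j)
  isInternal X := by
    have h := F.isInternal X
    rw [DirectSum.isInternal_submodule_iff_iSupIndep_and_iSup_eq_top] at h ⊢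
    refine ⟨h.1.comp (add_right_injective m), ?_⟩
    rw [← h.2]
    exact (Equiv.addLeft m).iSup_comp (g := F.deg X)
  action_mem {X Y f i j x} hf hx := by
    have := F.action_mem hf hx
    rwa [← add_assoc, add_comm i m, add_assoc] at this

variable (K) in
/-- The representable graded functor `Hom_D(-, X)`. -/
def representable (X : D) : GradedFunctor.{v} K D where
  toFunctorMod := KoszulCat.representable K X
  deg Y := GradedCategory.homDeg (K := K) Y X
  isInternal Y := GradedCategory.isInternal Y X
  action_mem hf hx := GradedCategory.comp_mem hf hx

/-- A graded functor `F` is linear if there is an exact sequence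
`⋯ ⟶ Hom_D(-, P 2)[-2] ⟶ Hom_D(-, P 1)[-1] ⟶ Hom_D(-, P 0) ⟶ F ⟶ 0`
in which all morphisms have degree zero. -/
def IsLinear (F : GradedFunctor.{v} K D) : Prop :=
  ∃ (P : ℕ → D)
    (d : ∀ n : ℕ, ((representable K (P (n + 1))).shift (-((n + 1 : ℕ) : ℤ))).toFunctorMod ⟶
      ((representable K (P n)).shift (-(n : ℤ))).toFunctorMod)
    (ε : (representable K (P 0)).toFunctorMod ⟶ F.toFunctorMod),
    (∀ n : ℕ, d n ∈ homDeg ((representable K (P (n + 1))).shift (-((n + 1 : ℕ) : ℤ)))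
      ((representable K (P n)).shift (-(n : ℤ))) 0) ∧
    ε ∈ homDeg (representable K (P 0)) F 0 ∧
    (∀ X : D, Function.Surjective (component ε X)) ∧
    (∀ X : D, Function.Exact (component (d 0) X) (component ε X)) ∧
    (∀ (n : ℕ) (X : D), Function.Exact (component (d (n + 1)) X) (component (d n) X))

end GradedFunctor

end Graded

section ExtCategory

open Abelian

variable {A : Type u} [Category.{v} A] [Abelian A] [HasExt.{w} A]

/-- The graded group `Ext^*(X, Y)`, the direct sum of all the `Ext^n(X, Y)`. -/
abbrev TotalExt (X Y : A) : Type w := DirectSum ℕ fun n => Ext.{w} X Y n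

/-- The composition (Yoneda product) `Ext^*(X, Y) × Ext^*(Y, Z) → Ext^*(X, Z)`. -/
noncomputable def totalComp (X Y Z : A) : TotalExt X Y →+ TotalExt Y Z →+ TotalExt X Z :=
  DirectSum.toAddMonoid fun a => AddMonoidHom.flip (DirectSum.toAddMonoid fun b =>
    AddMonoidHom.flip ((AddMonoidHom.compHom (DirectSum.of (fun n => Ext.{w} X Z n) (a + b))).comp
      (Ext.bilinearComp X Y Z a b (a + b) rfl)))

lemma totalComp_of {X Y Z : A} {a b c : ℕ} (α : Ext.{w} X Y a) (β : Ext.{w} Y Z b)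
    (h : a + b = c) :
    totalComp X Y Z (DirectSum.of _ a α) (DirectSum.of _ b β) =
      DirectSum.of (fun n => Ext.{w} X Z n) c (α.comp β h) := by
  subst h
  simp [totalComp]

/-- The degree zero element of `Ext^*(X, Y)` given by a morphism `f : X ⟶ Y`. -/
noncomputable def totalMk {X Y : A} (f : X ⟶ Y) : TotalExt X Y :=
  DirectSum.of (fun n => Ext.{w} X Y n) 0 (Ext.mk₀ f)

lemma totalMk_id_comp {X Y : A} (x : TotalExt X Y) : totalComp X X Y (totalMk (𝟙 X)) x = x := by
  induction x using DirectSum.induction_on with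
  | zero => exact map_zero _
  | of n α => rw [totalMk, totalComp_of _ _ (zero_add n), Ext.mk₀_id_comp]
  | add x y hx hy => rw [map_add, hx, hy]

lemma totalComp_mk_id {X Y : A} (x : TotalExt X Y) : totalComp X Y Y x (totalMk (𝟙 Y)) = x := by
  induction x using DirectSum.induction_on with
  | zero => rw [map_zero]; rfl
  | of n α => rw [totalMk, totalComp_of _ _ (add_zero n), Ext.comp_mk₀_id]
  | add x y hx hy => rw [map_add, AddMonoidHom.add_apply, hx, hy]

lemma totalComp_assoc {X Y Z T : A} (x : TotalExt X Y) (y : TotalExt Y Z) (z : TotalExt Z T) :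
    totalComp X Z T (totalComp X Y Z x y) z = totalComp X Y T x (totalComp Y Z T y z) := by
  induction x using DirectSum.induction_on with
  | zero => simp only [map_zero, AddMonoidHom.zero_apply]
  | add x x' hx hx' => simp only [map_add, AddMonoidHom.add_apply, hx, hx']
  | of a α =>
    induction y using DirectSum.induction_on with
    | zero => simp only [map_zero, AddMonoidHom.zero_apply]
    | add y y' hy hy' => simp only [map_add, AddMonoidHom.add_apply, hy, hy']
    | of b β =>
      induction z using DirectSum.induction_on with
      | zero => simp only [map_zero]
      | add z z' hz hz' => simp only [map_add, hz, hz']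
      | of c γ =>
        rw [totalComp_of α β rfl, totalComp_of β γ rfl, totalComp_of (α.comp β rfl) γ rfl,
          totalComp_of α (β.comp γ rfl) (add_assoc a b c).symm,
          Ext.comp_assoc α β γ rfl rfl rfl]

lemma totalMk_comp {X Y Z : A} (f : X ⟶ Y) (g : Y ⟶ Z) :
    totalMk.{w} (f ≫ g) = totalComp X Y Z (totalMk f) (totalMk g) := by
  rw [totalMk, totalMk, totalMk, totalComp_of _ _ (zero_add 0), Ext.mk₀_comp_mk₀]

/-- The `Ext`-category `E(P)` of the full subcategory of the abelian category `A` given by the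
property `P`: it has the same objects, and the morphisms from `X` to `Y` are the elements of
`⨁ n, Ext^n(X, Y)`, with the Yoneda product as composition. -/
structure ExtCategory {A : Type u} [Category.{v} A] [Abelian A] [HasExt.{w} A]
    (P : ObjectProperty A) where
  /-- The underlying object of `A`. -/
  obj : A
  property : P obj

namespace ExtCategory

variable {P : ObjectProperty A}

noncomputable instance : Category.{w} (ExtCategory P) where
  Hom X Y := TotalExt.{w} X.obj Y.obj
  id X := totalMk (𝟙 X.obj)
  comp f g := totalComp _ _ _ f g
  id_comp f := totalMk_id_comp f
  comp_id f := totalComp_mk_id f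
  assoc f g h := totalComp_assoc f g h

noncomputable instance (X Y : ExtCategory P) : AddCommGroup (X ⟶ Y) :=
  inferInstanceAs (AddCommGroup (TotalExt X.obj Y.obj))

noncomputable instance : Preadditive (ExtCategory P) where
  homGroup _ _ := inferInstance
  add_comp X Y Z f f' g := by
    change totalComp X.obj Y.obj Z.obj (f + f') g = _
    rw [map_add]
    rfl
  comp_add X Y Z f g g' := map_add (totalComp X.obj Y.obj Z.obj f) g g'

variable {K : Type t} [Field K] [Linear K A]

lemma totalComp_smul {X Y Z : A} (r : K) (x : TotalExt X Y) (y : TotalExt Y Z) :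
    totalComp X Y Z x (r • y) = r • totalComp X Y Z x y := by
  induction x using DirectSum.induction_on with
  | zero => simp only [map_zero, AddMonoidHom.zero_apply, smul_zero]
  | add x x' hx hx' => simp only [map_add, AddMonoidHom.add_apply, hx, hx', smul_add]
  | of a α =>
    induction y using DirectSum.induction_on with
    | zero => simp only [map_zero, smul_zero]
    | add y y' hy hy' => simp only [map_add, smul_add, hy, hy']
    | of b β =>
      rw [← DirectSum.of_smul, totalComp_of _ _ rfl, totalComp_of _ _ rfl, ← DirectSum.of_smul,
        Ext.comp_smul]

lemma smul_totalComp {X Y Z : A} (r : K) (x : TotalExt X Y) (y : TotalExt Y Z) :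
    totalComp X Y Z (r • x) y = r • totalComp X Y Z x y := by
  induction x using DirectSum.induction_on with
  | zero => simp only [map_zero, AddMonoidHom.zero_apply, smul_zero]
  | add x x' hx hx' => simp only [map_add, AddMonoidHom.add_apply, hx, hx', smul_add]
  | of a α =>
    induction y using DirectSum.induction_on with
    | zero => simp only [map_zero, smul_zero]
    | add y y' hy hy' => simp only [map_add, smul_add, hy, hy']
    | of b β =>
      rw [← DirectSum.of_smul, totalComp_of _ _ rfl, totalComp_of _ _ rfl, ← DirectSum.of_smul,
        Ext.smul_comp]

lemma totalComp_mem {X Y Z : A} {i j : ℤ} {x : TotalExt X Y} {y : TotalExt Y Z}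
    (hx : x ∈ natDeg K _ i) (hy : y ∈ natDeg K _ j) :
    totalComp X Y Z x y ∈ natDeg K _ (i + j) := by
  obtain rfl | ⟨a, α, rfl, rfl⟩ := exists_of_mem_natDeg K _ hx
  · rw [map_zero]
    exact zero_mem _
  obtain rfl | ⟨b, β, rfl, rfl⟩ := exists_of_mem_natDeg K _ hy
  · rw [map_zero]
    exact zero_mem _
  rw [totalComp_of α β rfl, ← Nat.cast_add]
  exact of_mem_natDeg K _ _ _

noncomputable instance (X Y : ExtCategory P) : Module K (X ⟶ Y) :=
  inferInstanceAs (Module K (TotalExt X.obj Y.obj))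

noncomputable instance : Linear K (ExtCategory P) where
  homModule _ _ := inferInstance
  smul_comp X Y Z r f g := smul_totalComp (X := X.obj) (Y := Y.obj) (Z := Z.obj) r f g
  comp_smul X Y Z f r g := totalComp_smul (X := X.obj) (Y := Y.obj) (Z := Z.obj) r f g

/-- The `Ext`-category is graded, with `Hom(X, Y)_i = Ext^i(X, Y)` for `i ≥ 0` and
`Hom(X, Y)_i = 0` for `i < 0`. -/
noncomputable instance : GradedCategory K (ExtCategory P) where
  homDeg X Y i := natDeg K (fun n => Ext.{w} X.obj Y.obj n) i
  isInternal _ _ := natDeg_isInternal K _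
  comp_mem hf hg := totalComp_mem hf hg

/-- The left multiplication by `x` in `Ext^*(X, Y)`, as a `K`-linear map. -/
noncomputable def totalCompLeft (K : Type t) [Field K] [Linear K A] {X Y : A} (x : TotalExt X Y)
    (Z : A) : TotalExt Y Z →ₗ[K] TotalExt X Z where
  toFun y := totalComp X Y Z x y
  map_add' := map_add _
  map_smul' r y := totalComp_smul r x y

/-- The right multiplication by `y` in `Ext^*(Y, Z)`, as a `K`-linear map. -/
noncomputable def totalCompRight (K : Type t) [Field K] [Linear K A] (X : A) {Y Z : A}
    (y : TotalExt Y Z) : TotalExt X Y →ₗ[K] TotalExt X Z where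
  toFun x := totalComp X Y Z x y
  map_add' x x' := by rw [map_add, AddMonoidHom.add_apply]
  map_smul' r x := smul_totalComp r x y

variable (K P)

/-- For an object `F` of `A`, the covariant functor `Ext^*(F, -) = ⨁ n, Ext^n(F, -)` on `E(P)`, as
a contravariant functor on `E(P)ᵒᵖ`. -/
noncomputable def extFunctorMod (F : A) : FunctorMod.{w} K (ExtCategory P)ᵒᵖ :=
  ⟨{ obj X := ModuleCat.of K (TotalExt F X.unop.unop.obj)
     map f := ModuleCat.ofHom (totalCompRight K F f.unop.unop)
     map_id _ := by
      refine ModuleCat.hom_ext (LinearMap.ext fun x => ?_)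
      exact totalComp_mk_id x
     map_comp f g := by
      refine ModuleCat.hom_ext (LinearMap.ext fun x => ?_)
      exact (totalComp_assoc x f.unop.unop g.unop.unop).symm },
    ⟨fun {X Y f g} => by
      refine ModuleCat.hom_ext (LinearMap.ext fun x => ?_)
      exact map_add (totalComp F X.unop.unop.obj Y.unop.unop.obj x) f.unop.unop g.unop.unop⟩,
    ⟨fun {X Y} f r => by
      refine ModuleCat.hom_ext (LinearMap.ext fun x => ?_)
      exact totalComp_smul r x f.unop.unop⟩⟩

/-- For an object `F` of `A`, the graded functor `Ext^*(F, -)` over `E(P)ᵒᵖ`, whose degree `i` part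
is `Ext^i(F, -)` for `i ≥ 0` and zero for `i < 0`. -/
noncomputable def extGradedFunctor (F : A) : GradedFunctor.{w} K (ExtCategory P)ᵒᵖ where
  toFunctorMod := extFunctorMod P K F
  deg X i := natDeg K (fun n => Ext.{w} F X.unop.obj n) i
  isInternal _ := natDeg_isInternal K _
  action_mem {X Y f i j x} hf hx := by
    obtain ⟨f, hf, rfl⟩ := hf
    have h := totalComp_mem (K := K) (X := F) (Y := Y.unop.obj) (Z := X.unop.obj) (y := f) hx hf
    rw [add_comm j i] at h
    exact h

/-- The contravariant functor `F ↦ Ext^*(F, -)` from `A` to `Gr(E(P)ᵒᵖ)`; it maps `η : F ⟶ G` to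
the left multiplication by `η`, which is of degree zero. -/
noncomputable def extFunctor : Aᵒᵖ ⥤ GradedFunctor.{w} K (ExtCategory P)ᵒᵖ where
  obj F := extGradedFunctor P K F.unop
  map {F G} η :=
    { toHom := ObjectProperty.homMk
        { app X := ModuleCat.ofHom (totalCompLeft K (totalMk η.unop) X.unop.unop.obj)
          naturality X Y f := by
            refine ModuleCat.hom_ext (LinearMap.ext fun x => ?_)
            exact (totalComp_assoc (totalMk η.unop) x f.unop.unop).symm }
      mem := by
        refine Submodule.mem_iSup_of_mem 0 fun X j x hx => ?_
        exact totalComp_mem (of_mem_natDeg K _ 0 _) hx }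
  map_id F := by
    refine GradedFunctor.Hom.ext ?_
    refine ObjectProperty.hom_ext _ (NatTrans.ext (funext fun X =>
      ModuleCat.hom_ext (LinearMap.ext fun x => ?_)))
    exact totalMk_id_comp x
  map_comp {F G H} η θ := by
    refine GradedFunctor.Hom.ext ?_
    refine ObjectProperty.hom_ext _ (NatTrans.ext (funext fun X =>
      ModuleCat.hom_ext (LinearMap.ext fun x => ?_)))
    refine (congrArg (fun y => totalComp _ _ _ y x) (totalMk_comp θ.unop η.unop)).trans ?_
    exact totalComp_assoc (totalMk θ.unop) (totalMk η.unop) x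

end ExtCategory

end ExtCategory

section KoszulDual

variable (K : Type t) [Field K] (C : Type u) [Category.{v} C] [Preadditive C] [Linear K C]

/-- The full additive subcategory `S(C)` of `Mod(C)` generated by the simple functors: the finite
direct sums of simple functors. -/
def isFiniteSumOfSimples : ObjectProperty (FunctorMod.{v} K C) :=
  fun F => ∃ (n : ℕ) (S : Fin n → FunctorMod.{v} K C), (∀ i, Simple (S i)) ∧ Nonempty (F ≅ ⨁ S)

/-- The property of being weakly Koszul, which defines the category of weakly Koszul functors as a
full subcategory of `Mod(C)`. -/
def weaklyKoszulFunctors : ObjectProperty (FunctorMod.{v} K C) := fun F => IsWeaklyKoszul F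

/-- The property of being linear, which defines the category of linear functors as a full
subcategory of `Gr(D)`. -/
def linearFunctors (D : Type u) [Category.{v} D] [Preadditive D] [Linear K D]
    [GradedCategory K D] : ObjectProperty (GradedFunctor.{v} K D) := fun F => F.IsLinear

variable [HasExt.{w} (FunctorMod.{v} K C)]

/-- The category `E(S(C))`: the `Ext`-category of the category `S(C)` of finite direct sums of
simple functors. -/
abbrev KoszulDual := ExtCategory (isFiniteSumOfSimples K C)

/-- The functor `φ : Mod(C)ᵒᵖ ⥤ Gr(E(S(C))ᵒᵖ)`, `φ(F) = Ext^*(F, -)`. -/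
noncomputable abbrev koszulFunctor :
    (FunctorMod.{v} K C)ᵒᵖ ⥤ GradedFunctor.{w} K (KoszulDual.{w} K C)ᵒᵖ :=
  ExtCategory.extFunctor (isFiniteSumOfSimples K C) K

end KoszulDual

end KoszulCat

/-! Write `R` for the radical, regarded as a subfunctor of the identity of `Mod(C)` preserving
epimorphisms, and `top G = G/RG`. Everything rests on one vanishing statement: for `F` weakly
Koszul, `X` a finite sum of simples and all `n, k`, the restriction `Ext^n(R^k F, X) → Ext^n(R^(k+1)
F, X)` is zero (`IsKoszulClass.extVanishes`).

Given this, the long exact sequences of `0 → R^(k+1) F → R^k F → top(R^k F) → 0` break into short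
exact ones, `0 → Ext^(n-1)(R^(k+1) F, X) → Ext^n(top(R^k F), X) → Ext^n(R^k F, X) → 0`. Splicing
them over all `k` gives a linear resolution of `Ext^*(F, -)` whose `k`-th term is represented by
`top(R^k F)` and whose differentials are Yoneda products with the degree one classes `topClass`. The
tops are finite sums of simples because the powers of the radical preserve finite generation.

The vanishing is proved by induction on `n`; for `n = 0` it is naturality of `R → id`, since `RX =
0`. For the step, take `0 → Ω → P → F → 0` from the Koszul resolution. The condition `R^(i+1) P ∩ Ω
= R^i Ω` says that the part of `R^(k+1) P` coming from `R^k Ω` is compatible with the radical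
filtrations. As `top(R^(k+1) P)` is semisimple, the projection to `top(R^k Ω)` therefore extends to
a map defined on `R^(k+1) P` (`exists_comp_eq_comp_topπ`). By induction classes in `Ext^m(R^k Ω, X)`
come from that top, so their restrictions extend to `R^(k+1) P` and are killed by a connecting map
(`extVanishes_step`).

This step presupposes the vanishing for `R^k P` with `P` projective, which is not automatic for `k >
0`. There one reduces to `Y = Hom(-, Z)` with `End Z` local. Its top is simple, hence weakly Koszul,
and `RY` is a direct summand of `Ω ⊕ Y` with `Ω` a syzygy of that simple
(`exists_syzygy_decomposition`); so `R^(k+1) Y` reduces to `R^k Ω` and `R^k Y`. The Koszul condition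
starts at `i = 1`, so the resolutions need not be minimal; working with direct summands avoids
projective covers altogether.

The properties of `E(S(C))^op` are separate: Schur's lemma gives the graded local endomorphism
rings, biproducts come from `Mod(C)`, and local finiteness follows by dimension shifting along
resolutions of simples, starting from finite dimensionality of `Hom/rad`. -/

namespace KoszulCat

open Abelian

/-! ### Preradicals and vanishing of restriction maps on Ext -/

section Preradical

/-- A preradical of an abelian category which preserves epimorphisms: a subfunctor of the identity
such that epimorphisms induce epimorphisms. -/
structure EpiPreradical (A : Type u) [Category.{v} A] where
  functor : A ⥤ A
  ι : ∀ G, functor.obj G ⟶ G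
  map_ι : ∀ {G H : A} (f : G ⟶ H), functor.map f ≫ ι H = ι G ≫ f
  mono_ι : ∀ G, Mono (ι G)
  epi_map : ∀ {G H : A} (f : G ⟶ H) [Epi f], Epi (functor.map f)

/-- Every subobject of `G` is a direct summand. -/
def SplitsSubobjects {A : Type u} [Category.{v} A] (G : A) : Prop :=
  ∀ ⦃H : A⦄ (i : H ⟶ G) [Mono i], ∃ r : G ⟶ H, i ≫ r = 𝟙 H

variable {A : Type u} [Category.{v} A]

/-- Since `g` kills the kernel of `f`, it is defined on the coimage of `f`, a subobject of `T`; a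
retraction of `T` onto it extends `g` to all of `T`. -/
lemma SplitsSubobjects.exists_factor [Abelian A] {T : A} (hT : SplitsSubobjects T) {W U : A} (f : W ⟶ T)
    (g : W ⟶ U) (h : kernel.ι f ≫ g = 0) : ∃ k : T ⟶ U, f ≫ k = g := by
  obtain ⟨r, hr⟩ := hT (Abelian.factorThruCoimage f)
  refine ⟨r ≫ cokernel.desc (kernel.ι f) g h, ?_⟩
  have h₁ : f = cokernel.π (kernel.ι f) ≫ Abelian.factorThruCoimage f := (Abelian.coimage.fac f).symm
  have h₂ := congrArg (fun k => k ≫ r ≫ cokernel.desc (kernel.ι f) g h) h₁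
  refine h₂.trans ?_
  rw [Category.assoc, reassoc_of% hr]
  exact cokernel.π_desc _ _ _

namespace EpiPreradical

attribute [instance] EpiPreradical.mono_ι

variable (ρ : EpiPreradical A)

/-- The powers of a preradical. -/
def pow : ℕ → A ⥤ A
  | 0 => 𝟭 A
  | k + 1 => pow k ⋙ ρ.functor

/-- The inclusion of the `k`-th power of a preradical. -/
def powι : ∀ (k : ℕ) (G : A), (ρ.pow k).obj G ⟶ G
  | 0, G => 𝟙 G
  | k + 1, G => ρ.ι ((ρ.pow k).obj G) ≫ powι k G

/-- The inclusion of a power of a preradical into the previous one. -/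
def powStep (k : ℕ) (G : A) : (ρ.pow (k + 1)).obj G ⟶ (ρ.pow k).obj G := ρ.ι _

lemma powι_succ (k : ℕ) (G : A) : ρ.powι (k + 1) G = ρ.powStep k G ≫ ρ.powι k G := rfl

instance mono_powι (k : ℕ) (G : A) : Mono (ρ.powι k G) := by
  induction k with
  | zero => exact inferInstanceAs (Mono (𝟙 G))
  | succ k ih =>
    have := ρ.mono_ι ((ρ.pow k).obj G)
    exact mono_comp (ρ.ι ((ρ.pow k).obj G)) (ρ.powι k G)

lemma map_powι (k : ℕ) {G H : A} (f : G ⟶ H) :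
    (ρ.pow k).map f ≫ ρ.powι k H = ρ.powι k G ≫ f := by
  induction k with
  | zero => exact (Category.comp_id _).trans (Category.id_comp _).symm
  | succ k ih =>
    change ρ.functor.map ((ρ.pow k).map f) ≫ ρ.ι _ ≫ ρ.powι k H = (ρ.ι _ ≫ _) ≫ f
    rw [reassoc_of% (ρ.map_ι ((ρ.pow k).map f)), ih, Category.assoc]

lemma epi_pow_map (k : ℕ) {G H : A} (f : G ⟶ H) [Epi f] : Epi ((ρ.pow k).map f) := by
  induction k with
  | zero => exact inferInstanceAs (Epi f)
  | succ k ih => exact ρ.epi_map _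

/-- The powers are defined by applying `R` last; here it is applied first, so that a decomposition
of `R G` can be fed into the `k`-th power. -/
lemma pow_succ_obj (k : ℕ) (G : A) :
    (ρ.pow (k + 1)).obj G = (ρ.pow k).obj (ρ.functor.obj G) := by
  induction k with
  | zero => rfl
  | succ k ih => exact congrArg ρ.functor.obj ih

variable [Abelian A]

instance : ρ.functor.Additive where
  map_add {G H f g} := by
    rw [← cancel_mono (ρ.ι H), map_ι, Preadditive.add_comp, map_ι, map_ι, Preadditive.comp_add]

instance pow_additive (k : ℕ) : (ρ.pow k).Additive where
  map_add {G H f g} := by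
    rw [← cancel_mono (ρ.powι k H), map_powι, Preadditive.add_comp, map_powι, map_powι,
      Preadditive.comp_add]

/-- The largest quotient of `G` which the preradical sees as its top. -/
noncomputable def top (G : A) : A := cokernel (ρ.ι G)

/-- The projection of an object on its top. -/
noncomputable def topπ (G : A) : G ⟶ ρ.top G := cokernel.π (ρ.ι G)

instance (G : A) : Epi (ρ.topπ G) := inferInstanceAs (Epi (cokernel.π _))

@[simp]
lemma ι_topπ (G : A) : ρ.ι G ≫ ρ.topπ G = 0 := cokernel.condition _

lemma powStep_topπ (k : ℕ) (G : A) : ρ.powStep k G ≫ ρ.topπ ((ρ.pow k).obj G) = 0 :=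
  cokernel.condition _

lemma top_shortExact (G : A) : (ShortComplex.mk _ _ (ρ.ι_topπ G)).ShortExact where
  exact := ShortComplex.exact_cokernel _
  mono_f := ρ.mono_ι G
  epi_g := inferInstanceAs (Epi (ρ.topπ G))

lemma top_pow_shortExact (k : ℕ) (G : A) :
    (ShortComplex.mk _ _ (ρ.powStep_topπ k G)).ShortExact :=
  ρ.top_shortExact _

section Ext

variable [HasExt.{w} A]

/-- The restriction `Ext^n(G, X) → Ext^n(R G, X)` vanishes for all objects `X` with `R X = 0`. -/
def ExtVanishes (n : ℕ) (G : A) : Prop :=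
  ∀ (X : A), ρ.ι X = 0 → ∀ x : Ext.{w} G X n,
    (Ext.mk₀ (ρ.ι G)).comp x (zero_add n) = 0

variable {ρ}

/-- By naturality a map `G ⟶ X` restricted to `R G` factors through `R X ⟶ X`, which is zero. -/
lemma extVanishes_zero (G : A) : ρ.ExtVanishes 0 G := by
  intro X hX x
  obtain ⟨f, rfl⟩ := (Ext.mk₀_bijective _ _).2 x
  rw [Ext.mk₀_comp_mk₀, ← map_ι, hX, comp_zero, Ext.mk₀_zero]

/-- Exactness at `Ext^n(G, X)` in the long sequence of `0 → R G → G → top G → 0`: a class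
restricting to zero on `R G` comes from the top. -/
lemma ExtVanishes.exists_top {n : ℕ} {G : A} (h : ρ.ExtVanishes n G) {X : A}
    (hX : ρ.ι X = 0) (x : Ext.{w} G X n) :
    ∃ y : Ext.{w} (ρ.top G) X n, (Ext.mk₀ (ρ.topπ G)).comp y (zero_add n) = x :=
  Ext.contravariant_sequence_exact₂ (ρ.top_shortExact G) X x (h X hX x)

/-- The inclusion `R G ⟶ G` is a sum of maps factoring through the inclusions `R (Y j) ⟶ Y j`. Only
the identity of `G` has to decompose: `G` is a retract of the sum of the `Y j`, which need not
themselves be summands of `G`. -/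
lemma extVanishes_of_sum {n : ℕ} {G : A} {J : Type*} [Fintype J] {Y : J → A} (p : ∀ j, G ⟶ Y j)
    (s : ∀ j, Y j ⟶ G) (hps : ∑ j, p j ≫ s j = 𝟙 G) (h : ∀ j, ρ.ExtVanishes n (Y j)) :
    ρ.ExtVanishes n G := by
  intro X hX x
  have : ρ.ι G = ∑ j, (ρ.functor.map (p j) ≫ ρ.ι (Y j)) ≫ s j := by
    conv_lhs => rw [← Category.comp_id (ρ.ι G), ← hps, Preadditive.comp_sum]
    refine Finset.sum_congr rfl fun j _ => ?_
    rw [map_ι, Category.assoc]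
  rw [this, Ext.mk₀_sum, Ext.sum_comp]
  refine Finset.sum_eq_zero fun j _ => ?_
  rw [Category.assoc, ← Ext.mk₀_comp_mk₀_assoc, ← Ext.mk₀_comp_mk₀_assoc, h j X hX, Ext.comp_zero]

lemma extVanishes_of_add {n : ℕ} {G Y₁ Y₂ : A} (p₁ : G ⟶ Y₁) (s₁ : Y₁ ⟶ G) (p₂ : G ⟶ Y₂)
    (s₂ : Y₂ ⟶ G) (hps : p₁ ≫ s₁ + p₂ ≫ s₂ = 𝟙 G) (h₁ : ρ.ExtVanishes n Y₁)
    (h₂ : ρ.ExtVanishes n Y₂) : ρ.ExtVanishes n G :=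
  extVanishes_of_sum (J := Bool) (Y := fun b => bif b then Y₁ else Y₂)
    (fun b => match b with | true => p₁ | false => p₂)
    (fun b => match b with | true => s₁ | false => s₂) (by simpa using hps)
    (fun b => match b with | true => h₁ | false => h₂)

lemma extVanishes_of_projective {n : ℕ} {P : A} [Projective P] : ρ.ExtVanishes (n + 1) P := by
  intro X hX x
  rw [Ext.eq_zero_of_projective x, Ext.comp_zero]

end Ext

/-- The place where the Koszul condition enters. The part of `W` that `q` sends into `R^(k+2) P` is
sent by `r` into `R^(k+1) Ω`, because it lies in `R^(k+2) P ∩ Ω`. Hence `r`, modulo `R^(k+1) Ω`,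
depends only on the image of `W` in `top(R^(k+1) P)`, and subobjects of that top split. -/
lemma exists_comp_eq_comp_topπ {Ω P F : A} {j : Ω ⟶ P} {p : P ⟶ F} [Mono j] (hjp : j ≫ p = 0) {k : ℕ}
    (a : (ρ.pow (k + 1)).obj Ω ⟶ (ρ.pow (k + 2)).obj P)
    (ha : a ≫ ρ.powι (k + 2) P = ρ.powι (k + 1) Ω ≫ j) (hap : a ≫ (ρ.pow (k + 2)).map p = 0)
    (hex : (ShortComplex.mk _ _ hap).Exact)
    (hsplit : SplitsSubobjects (ρ.top ((ρ.pow (k + 1)).obj P)))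
    {W : A} (q : W ⟶ (ρ.pow (k + 1)).obj P) (r : W ⟶ (ρ.pow k).obj Ω)
    (hqr : q ≫ ρ.powι (k + 1) P = r ≫ ρ.powι k Ω ≫ j) :
    ∃ θ : (ρ.pow (k + 1)).obj P ⟶ ρ.top ((ρ.pow k).obj Ω), q ≫ θ = r ≫ ρ.topπ _ := by
  have T := ρ.top_pow_shortExact (k + 1) P
  set N := kernel.ι (q ≫ ρ.topπ ((ρ.pow (k + 1)).obj P))
  have := T.mono_f
  have hN : (N ≫ q) ≫ ρ.topπ ((ρ.pow (k + 1)).obj P) = 0 := by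
    rw [Category.assoc]
    exact kernel.condition _
  let n' : _ ⟶ (ρ.pow (k + 2)).obj P := T.exact.lift (N ≫ q) hN
  have hn' : n' ≫ ρ.powStep (k + 1) P = N ≫ q := T.exact.lift_f _ _
  -- Inside `P` this part of `W` lies in `Ω`, by `hqr`, so it dies in `F`.
  have hn'p : n' ≫ (ρ.pow (k + 2)).map p = 0 := by
    rw [← cancel_mono (ρ.powι (k + 2) F), zero_comp, Category.assoc, map_powι]
    rw [powι_succ, Category.assoc, reassoc_of% hn', reassoc_of% hqr, hjp, comp_zero, comp_zero, comp_zero]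
  have hmono : Mono a := by
    have : Mono (a ≫ ρ.powι (k + 2) P) := by
      rw [ha]
      infer_instance
    exact mono_of_mono _ (ρ.powι (k + 2) P)
  let n'' : _ ⟶ (ρ.pow (k + 1)).obj Ω := hex.lift n' hn'p
  have hn'' : n'' ≫ a = n' := hex.lift_f _ _
  have hNr : N ≫ r = n'' ≫ ρ.powStep k Ω := by
    rw [← cancel_mono (ρ.powι k Ω ≫ j), Category.assoc, Category.assoc, ← hqr, ← reassoc_of% hn',
      ← hn'', Category.assoc, ← powι_succ, ha, powι_succ, Category.assoc]
  obtain ⟨θ, hθ⟩ := hsplit.exists_factor (q ≫ ρ.topπ _) (r ≫ ρ.topπ _) (by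
    change N ≫ _ = 0
    rw [reassoc_of% hNr, powStep_topπ, comp_zero])
  exact ⟨ρ.topπ _ ≫ θ, by rw [← hθ, Category.assoc]⟩

/-- A class `𝒦` of objects which have presentations by objects in the class `𝒬` of projective
objects, with syzygies in `𝒦` and compatible with the powers of the preradical. -/
structure IsKoszulClass (𝒬 𝒦 : A → Prop) : Prop where
  projective : ∀ P, 𝒬 P → Projective P
  splitsSubobjects : ∀ P, 𝒬 P → ∀ k, SplitsSubobjects (ρ.top ((ρ.pow (k + 1)).obj P))
  decomposition : ∀ P, 𝒬 P → ∃ (n : ℕ) (Y : Fin n → A) (p : ∀ i, P ⟶ Y i) (s : ∀ i, Y i ⟶ P),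
    ∑ i, p i ≫ s i = 𝟙 P ∧ ∀ i, 𝒬 (Y i) ∧ 𝒦 (ρ.top (Y i))
  presentation : ∀ F, 𝒦 F → ∃ (Ω P : A) (j : Ω ⟶ P) (p : P ⟶ F) (w : j ≫ p = 0),
    (ShortComplex.mk j p w).ShortExact ∧ 𝒬 P ∧ 𝒦 Ω ∧
    ∀ k, ∃ (a : (ρ.pow (k + 1)).obj Ω ⟶ (ρ.pow (k + 2)).obj P)
      (hap : a ≫ (ρ.pow (k + 2)).map p = 0),
      a ≫ ρ.powι (k + 2) P = ρ.powι (k + 1) Ω ≫ j ∧ (ShortComplex.mk _ _ hap).Exact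

variable {ρ}

/-- If `Y` is projective, then `R Y` is a direct summand of the sum of `Y` and a syzygy of its
top. -/
lemma exists_syzygy_decomposition {Y Q Ω : A} [Projective Y] [Projective Q] {j : Ω ⟶ Q}
    {p : Q ⟶ ρ.top Y} {w : j ≫ p = 0} (hS : (ShortComplex.mk j p w).ShortExact) :
    ∃ (a : ρ.functor.obj Y ⟶ Ω) (b : Ω ⟶ ρ.functor.obj Y) (h : Y ⟶ ρ.functor.obj Y),
      a ≫ b + ρ.ι Y ≫ h = 𝟙 _ := by
  have := hS.mono_f
  have : Epi p := hS.epi_g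
  have hT := ρ.top_shortExact Y
  have := hT.mono_f
  let f : Y ⟶ Q := Projective.factorThru (ρ.topπ Y) p
  let g : Q ⟶ Y := Projective.factorThru p (ρ.topπ Y)
  have hf : f ≫ p = ρ.topπ Y := Projective.factorThru_comp _ _
  have hg : g ≫ ρ.topπ Y = p := Projective.factorThru_comp _ _
  -- A Schanuel-type comparison of the covers `Y` and `Q` of `top Y`: both `f` and `g` lie over the
  -- identity of `top Y`, so `1 - f ≫ g` lands in `R Y`, while `f` and `g` restrict to maps `a`, `b`
  -- between `R Y` and `Ω`. On `R Y` the sum becomes `f ≫ g + (1 - f ≫ g)`.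
  let h : Y ⟶ ρ.functor.obj Y := hT.exact.lift (𝟙 Y - f ≫ g) (by
    dsimp only
    rw [Preadditive.sub_comp, Category.assoc, hg, hf, Category.id_comp, sub_self])
  have hh : h ≫ ρ.ι Y = 𝟙 Y - f ≫ g := hT.exact.lift_f _ _
  let a : ρ.functor.obj Y ⟶ Ω := hS.exact.lift (ρ.ι Y ≫ f) (by
    dsimp only
    rw [Category.assoc, hf, ι_topπ])
  have ha : a ≫ j = ρ.ι Y ≫ f := hS.exact.lift_f _ _
  let b : Ω ⟶ ρ.functor.obj Y := hT.exact.lift (j ≫ g) (by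
    dsimp only
    rw [Category.assoc, hg, w])
  have hb : b ≫ ρ.ι Y = j ≫ g := hT.exact.lift_f _ _
  refine ⟨a, b, h, ?_⟩
  rw [← cancel_mono (ρ.ι Y), Preadditive.add_comp, Category.assoc, Category.assoc, hb, hh,
    reassoc_of% ha, Preadditive.comp_sub, Category.comp_id, add_sub_cancel, Category.id_comp]

section Ext

variable {𝒬 𝒦 : A → Prop} (hρ : ρ.IsKoszulClass 𝒬 𝒦)

variable [HasExt.{w} A]

include hρ

/-- Dimension shifting: the restriction of a class in `Ext^(m+1)(R^k F, X)` is a connecting image of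
a class in `Ext^m`, and the latter extends to the middle term `R^(k+1) P`, so the connecting map
kills it. -/
lemma IsKoszulClass.extVanishes_step {m : ℕ} (ih : ∀ k F, 𝒦 F → ρ.ExtVanishes m ((ρ.pow k).obj F))
    (k : ℕ) (hP : ∀ P, 𝒬 P → ρ.ExtVanishes (m + 1) ((ρ.pow k).obj P)) {F : A} (hF : 𝒦 F) :
    ρ.ExtVanishes (m + 1) ((ρ.pow k).obj F) := by
  obtain ⟨Ω, P, j, p, hjp, hS, hP', hΩ, ha⟩ := hρ.presentation F hF
  have := hS.mono_f
  have : Epi p := hS.epi_g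
  have := hρ.projective P hP'
  -- By `ih` the class `x` is pulled back from `top(R^k Ω)`, and the projection onto that top,
  -- restricted along `r`, extends along `q`.
  have key : ∀ {W : A} (q : W ⟶ (ρ.pow (k + 1)).obj P) (r : W ⟶ (ρ.pow k).obj Ω),
      q ≫ ρ.powι (k + 1) P = r ≫ ρ.powι k Ω ≫ j → ∀ (X : A), ρ.ι X = 0 →
      ∀ x : Ext.{w} ((ρ.pow k).obj Ω) X m, ∃ y : Ext.{w} ((ρ.pow (k + 1)).obj P) X m,
        (Ext.mk₀ r).comp x (zero_add m) = (Ext.mk₀ q).comp y (zero_add m) := by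
    intro W q r hqr X hX x
    obtain ⟨a, hap, ha, hex⟩ := ha k
    obtain ⟨θ, hθ⟩ := ρ.exists_comp_eq_comp_topπ hjp a ha hap hex (hρ.splitsSubobjects P hP' k) q r hqr
    obtain ⟨y, rfl⟩ := (ih k Ω hΩ).exists_top hX x
    refine ⟨(Ext.mk₀ θ).comp y (zero_add m), ?_⟩
    rw [Ext.mk₀_comp_mk₀_assoc, Ext.mk₀_comp_mk₀_assoc, hθ]
  intro X hX e
  cases k with
  | zero =>
    -- For `k = 0` the kernel of `R P ⟶ R F` is `Ω ∩ R P`, which may differ from `Ω`, since no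
    -- inclusion of `Ω` in `R P` is assumed.
    let W := kernel (ρ.functor.map p)
    have hepi := ρ.epi_map p
    have hT : (ShortComplex.mk _ _ (kernel.condition (ρ.functor.map p))).ShortExact :=
      { exact := ShortComplex.exact_kernel _
        mono_f := inferInstanceAs (Mono (kernel.ι _))
        epi_g := hepi }
    let r : W ⟶ Ω := hS.exact.lift (kernel.ι (ρ.functor.map p) ≫ ρ.ι P) (by
      dsimp only
      rw [Category.assoc, ← map_ι, kernel.condition_assoc, zero_comp])
    have hr : r ≫ j = kernel.ι (ρ.functor.map p) ≫ ρ.ι P := hS.exact.lift_f _ _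
    let φ : ShortComplex.mk _ _ (kernel.condition (ρ.functor.map p)) ⟶ ShortComplex.mk j p hjp :=
      { τ₁ := r
        τ₂ := ρ.ι P
        τ₃ := ρ.ι F
        comm₁₂ := hr
        comm₂₃ := (ρ.map_ι p).symm }
    obtain ⟨x, hx⟩ := Ext.contravariant_sequence_exact₃ hS X e (Ext.eq_zero_of_projective _)
      (add_comm 1 m)
    have hnat : (Ext.mk₀ (ρ.ι F)).comp hS.extClass (zero_add 1) =
        hT.extClass.comp (Ext.mk₀ r) (add_zero 1) :=
      (ShortComplex.ShortExact.extClass_naturality hT hS φ).symm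
    change (Ext.mk₀ (ρ.ι F)).comp e _ = 0
    obtain ⟨y, hy⟩ := key (kernel.ι (ρ.functor.map p)) r (by
      refine (congrArg (fun f => kernel.ι (ρ.functor.map p) ≫ f) (Category.comp_id (ρ.ι P))).trans ?_
      rw [← hr]
      exact congrArg (fun f => r ≫ f) (Category.id_comp j).symm) X hX x
    have h₁ : (Ext.mk₀ (ρ.ι F)).comp e (zero_add (m + 1)) =
        hT.extClass.comp ((Ext.mk₀ r).comp x (zero_add m)) (add_comm 1 m) := by
      rw [← hx]
      erw [← Ext.comp_assoc (Ext.mk₀ (ρ.ι F)) hS.extClass x (zero_add 1) (add_comm 1 m) (by lia)]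
      rw [hnat, Ext.comp_assoc_of_second_deg_zero]
    exact h₁.trans ((congrArg (fun z => hT.extClass.comp z (add_comm 1 m)) hy).trans
      (hT.extClass_comp_assoc y))
  | succ k =>
    obtain ⟨a, hap, ha, hex⟩ := ha k
    have hmono : Mono a := by
      have : Mono (a ≫ ρ.powι (k + 2) P) := by
        rw [ha]
        infer_instance
      exact mono_of_mono _ (ρ.powι (k + 2) P)
    have hT : (ShortComplex.mk _ _ hap).ShortExact :=
      { exact := hex
        mono_f := hmono
        epi_g := ρ.epi_pow_map (k + 2) p }
    -- The class pulled back to `R^(k+2) P` is the restriction of a class on `R^(k+1) P`; for `k >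
    -- 0` it is the projective case `hP` that makes it vanish.
    have h₀ : (Ext.mk₀ ((ρ.pow (k + 2)).map p)).comp
        ((Ext.mk₀ (ρ.powStep (k + 1) F)).comp e (zero_add (m + 1))) (zero_add (m + 1)) = 0 := by
      rw [Ext.mk₀_comp_mk₀_assoc]
      have : (ρ.pow (k + 2)).map p ≫ ρ.powStep (k + 1) F =
        ρ.powStep (k + 1) P ≫ (ρ.pow (k + 1)).map p := ρ.map_ι _
      rw [this, ← Ext.mk₀_comp_mk₀_assoc]
      exact hP P hP' X hX _
    obtain ⟨x, hx⟩ := Ext.contravariant_sequence_exact₃ hT X _ h₀ (add_comm 1 m)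
    -- Here `a` is the first map of the sequence `hT` itself, so `x` is the restriction of a class
    -- on its middle term.
    obtain ⟨y, hy⟩ := key a (𝟙 _) (by rw [ha, Category.id_comp]) X hX x
    rw [Ext.mk₀_id_comp] at hy
    change (Ext.mk₀ (ρ.powStep (k + 1) F)).comp e _ = 0
    rw [← hx, hy]
    exact hT.extClass_comp_assoc y

/-- A double induction: for fixed degree the projectives are settled by induction on `k`, using
`extVanishes_step` for syzygies at the smaller power; the same step then passes from projectives to
all of `𝒦`. -/
theorem IsKoszulClass.extVanishes (n k : ℕ) {F : A} (hF : 𝒦 F) :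
    ρ.ExtVanishes n ((ρ.pow k).obj F) := by
  induction n generalizing k F with
  | zero => exact extVanishes_zero _
  | succ m ihm =>
    have hP : ∀ P, 𝒬 P → ρ.ExtVanishes (m + 1) ((ρ.pow k).obj P) := by
      induction k with
      | zero =>
        intro P hP
        have := hρ.projective P hP
        exact extVanishes_of_projective (P := P)
      | succ k ihk =>
        intro P hP
        obtain ⟨n, Y, p, s, hps, hY⟩ := hρ.decomposition P hP
        refine extVanishes_of_sum (fun i => (ρ.pow (k + 1)).map (p i))
          (fun i => (ρ.pow (k + 1)).map (s i)) ?_ fun i => ?_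
        · simp only [← Functor.map_comp, ← Functor.map_sum, hps]
          exact CategoryTheory.Functor.map_id _ _
        · obtain ⟨Ω, Q, j, q, hjq, hS, hQ, hΩ, -⟩ := hρ.presentation _ (hY i).2
          have := hρ.projective Q hQ
          have := hρ.projective _ (hY i).1
          obtain ⟨a, b, h, hab⟩ := exists_syzygy_decomposition hS
          -- `R^(k+1) Y = R^k (R Y)`, and `R Y` is a summand of `Ω ⊕ Y`; both pieces now involve
          -- only the power `k`.
          rw [pow_succ_obj]
          refine extVanishes_of_add ((ρ.pow k).map a) ((ρ.pow k).map b) ((ρ.pow k).map (ρ.ι (Y i)))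
            ((ρ.pow k).map h) ?_ (hρ.extVanishes_step (fun k F hF => ihm k hF) k ihk hΩ)
            (ihk _ (hY i).1)
          simp only [← Functor.map_comp, ← Functor.map_add, hab]
          exact CategoryTheory.Functor.map_id _ _
    exact hρ.extVanishes_step (fun k F hF => ihm k hF) k hP hF

end Ext

end EpiPreradical

end Preradical

/-! ### Pointwise description of `Mod(C)` and subfunctors -/

section Components

variable {K : Type t} [Field K] {C : Type u} [Category.{v} C] [Preadditive C] [Linear K C]

instance preservesHomology_ι : (isLinearFunctor.{w} K C).ι.PreservesHomology where
  preservesKernels := (isLinearFunctor.{w} K C).preservesKernels_ι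
  preservesCokernels := (isLinearFunctor.{w} K C).preservesCokernels_ι

variable {F G H : FunctorMod.{w} K C}

lemma functorMod_hom_ext {η θ : F ⟶ G} (h : ∀ X x, component η X x = component θ X x) : η = θ := by
  ext X x
  exact h X.unop x

lemma component_id (X : C) (x : F.obj.obj (op X)) : component (𝟙 F) X x = x := rfl

lemma component_comp (η : F ⟶ G) (θ : G ⟶ H) (X : C) (x : F.obj.obj (op X)) :
    component (η ≫ θ) X x = component θ X (component η X x) := rfl

lemma component_comp' (η : F ⟶ G) (θ : G ⟶ H) (X : C) :
    component (η ≫ θ) X = component θ X ∘ₗ component η X := rfl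

lemma component_zero (X : C) (x : F.obj.obj (op X)) : component (0 : F ⟶ G) X x = 0 := rfl

lemma component_add (η θ : F ⟶ G) (X : C) (x : F.obj.obj (op X)) :
    component (η + θ) X x = component η X x + component θ X x := rfl

lemma component_sum {J : Type*} (s : Finset J) (η : J → (F ⟶ G)) (X : C) (x : F.obj.obj (op X)) :
    component (∑ j ∈ s, η j) X x = ∑ j ∈ s, component (η j) X x := by
  classical
  induction s using Finset.induction_on with
  | empty => simp only [Finset.sum_empty, component_zero]
  | insert a s ha ih => rw [Finset.sum_insert ha, Finset.sum_insert ha, component_add, ih]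

lemma action_id (X : C) (x : F.obj.obj (op X)) : action F (𝟙 X) x = x := by
  change (F.obj.map (𝟙 (op X))).hom x = x
  rw [CategoryTheory.Functor.map_id]
  rfl

lemma action_comp {X Y Z : C} (f : X ⟶ Y) (g : Y ⟶ Z) (z : F.obj.obj (op Z)) :
    action F (f ≫ g) z = action F f (action F g z) := by
  change (F.obj.map (g.op ≫ f.op)).hom z = _
  rw [CategoryTheory.Functor.map_comp]
  rfl

lemma action_add {X Y : C} (f g : X ⟶ Y) (y : F.obj.obj (op Y)) :
    action F (f + g) y = action F f y + action F g y := by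
  have := F.property.1
  change (F.obj.map (f.op + g.op)).hom y = _
  rw [Functor.map_add]
  rfl

lemma action_smul {X Y : C} (r : K) (f : X ⟶ Y) (y : F.obj.obj (op Y)) :
    action F (r • f) y = r • action F f y := by
  have := F.property.1
  have := F.property.2
  change (F.obj.map (r • f.op)).hom y = _
  rw [Functor.map_smul]
  rfl

lemma action_zero {X Y : C} (y : F.obj.obj (op Y)) : action F (0 : X ⟶ Y) y = 0 := by
  have := action_smul (F := F) (0 : K) (0 : X ⟶ Y) y
  rwa [zero_smul, zero_smul] at this

lemma component_action (η : F ⟶ G) {X Y : C} (f : X ⟶ Y) (y : F.obj.obj (op Y)) :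
    component η X (action F f y) = action G f (component η Y y) := by
  exact congrArg (fun k => k.hom y) (η.hom.naturality f.op)

lemma exact_of_component (S : ShortComplex (FunctorMod.{w} K C))
    (h : ∀ X : C, Function.Exact (component S.f X) (component S.g X)) : S.Exact := by
  rw [← S.exact_map_iff_of_faithful (isLinearFunctor.{w} K C).ι, ShortComplex.exact_iff_isZero_homology,
    Functor.isZero_iff]
  intro X
  refine IsZero.of_iso ?_ (((S.map (isLinearFunctor.{w} K C).ι).mapHomologyIso
    ((evaluation _ _).obj X)).symm)
  rw [← ShortComplex.exact_iff_isZero_homology, ShortComplex.moduleCat_exact_iff]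
  intro x hx
  exact (h X.unop x).1 hx

lemma exact_component {S : ShortComplex (FunctorMod.{w} K C)} (hS : S.Exact) (X : C) :
    Function.Exact (component S.f X) (component S.g X) := by
  have h := (hS.map (isLinearFunctor.{w} K C).ι).map ((evaluation _ _).obj (op X))
  rw [ShortComplex.moduleCat_exact_iff] at h
  intro x
  refine ⟨h x, ?_⟩
  rintro ⟨y, rfl⟩
  rw [← component_comp, S.zero, component_zero]

lemma epi_of_surjective (η : F ⟶ G) (h : ∀ X, Function.Surjective (component η X)) : Epi η where
  left_cancellation a b hab := functorMod_hom_ext fun X x => by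
    obtain ⟨y, rfl⟩ := h X x
    rw [← component_comp, ← component_comp, hab]

lemma mono_of_injective (η : F ⟶ G) (h : ∀ X, Function.Injective (component η X)) : Mono η where
  right_cancellation a b hab := functorMod_hom_ext fun X x => h X (by
    rw [← component_comp, ← component_comp, hab])

lemma component_surjective (η : F ⟶ G) [Epi η] (X : C) : Function.Surjective (component η X) := by
  have h := exact_component ((ShortComplex.mk η (0 : G ⟶ G) comp_zero).exact_iff_epi rfl |>.2 ‹_›) X
  intro x
  exact (h x).1 rfl

lemma component_injective (η : F ⟶ G) [Mono η] (X : C) : Function.Injective (component η X) := by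
  have h := exact_component ((ShortComplex.mk (0 : F ⟶ F) η zero_comp).exact_iff_mono rfl |>.2 ‹_›) X
  rw [injective_iff_map_eq_zero]
  intro x hx
  obtain ⟨y, rfl⟩ := (h x).1 hx
  rfl

/-- The bridge from inclusions of subspaces to morphisms: `g` vanishes in the cokernel of `i`, and
`i` is the kernel of that cokernel. -/
lemma exists_lift_of_range_le (i : G ⟶ H) [Mono i] (g : F ⟶ H)
    (h : ∀ X, LinearMap.range (component g X) ≤ LinearMap.range (component i X)) :
    ∃ a : F ⟶ G, a ≫ i = g := by
  have hex := ShortComplex.exact_cokernel i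
  have hz : g ≫ cokernel.π i = 0 := functorMod_hom_ext fun X x => by
    obtain ⟨y, hy⟩ := h X ⟨x, rfl⟩
    rw [component_comp, ← hy, ← component_comp, cokernel.condition, component_zero, component_zero]
  have : Mono (ShortComplex.mk i _ (cokernel.condition i)).f := ‹_›
  exact ⟨hex.lift g hz, hex.lift_f g hz⟩

/-- A family of subspaces `U(X) ⊆ F(X)` is a subfunctor. -/
def IsSubfunctor (F : FunctorMod.{w} K C) (U : ∀ X : C, Submodule K (F.obj.obj (op X))) : Prop :=
  ∀ ⦃X Y : C⦄ (f : X ⟶ Y), ∀ y ∈ U Y, action F f y ∈ U X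

/-- The underlying functor of a subfunctor. -/
def subfunctorObj {U : ∀ X : C, Submodule K (F.obj.obj (op X))} (hU : IsSubfunctor F U) :
    Cᵒᵖ ⥤ ModuleCat.{w} K where
  obj X := ModuleCat.of K (U X.unop)
  map {X Y} f := ModuleCat.ofHom ((F.obj.map f).hom.restrict (fun y hy => hU f.unop y hy))
  map_id X := by
    refine ModuleCat.hom_ext (LinearMap.ext fun x => Subtype.ext ?_)
    exact action_id X.unop x.1
  map_comp f g := by
    refine ModuleCat.hom_ext (LinearMap.ext fun x => Subtype.ext ?_)
    exact action_comp g.unop f.unop x.1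

/-- The inclusion of the underlying functor of a subfunctor. -/
def subfunctorHom {U : ∀ X : C, Submodule K (F.obj.obj (op X))} (hU : IsSubfunctor F U) :
    subfunctorObj hU ⟶ F.obj where
  app X := ModuleCat.ofHom (U X.unop).subtype
  naturality _ _ _ := rfl

instance {U : ∀ X : C, Submodule K (F.obj.obj (op X))} (hU : IsSubfunctor F U) :
    Mono (subfunctorHom hU) := by
  have : ∀ X, Mono ((subfunctorHom hU).app X) := fun X =>
    (ModuleCat.mono_iff_injective _).2 (Submodule.injective_subtype _)
  exact NatTrans.mono_of_mono_app _

/-- A subfunctor, as an object of `Mod(C)`. -/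
def subfunctor {U : ∀ X : C, Submodule K (F.obj.obj (op X))} (hU : IsSubfunctor F U) :
    FunctorMod.{w} K C :=
  ⟨subfunctorObj hU, (isLinearFunctor.{w} K C).prop_of_mono (subfunctorHom hU) F.property⟩

/-- The inclusion of a subfunctor. -/
def subfunctorι {U : ∀ X : C, Submodule K (F.obj.obj (op X))} (hU : IsSubfunctor F U) :
    subfunctor hU ⟶ F :=
  ObjectProperty.homMk (subfunctorHom hU)

section

variable {U : ∀ X : C, Submodule K (F.obj.obj (op X))} (hU : IsSubfunctor F U)

lemma component_subfunctorι_injective (X : C) :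
    Function.Injective (component (subfunctorι hU) X) :=
  Submodule.injective_subtype (U X)

lemma range_subfunctorι (X : C) : LinearMap.range (component (subfunctorι hU) X) = U X :=
  Submodule.range_subtype (U X)

instance : Mono (subfunctorι hU) := mono_of_injective _ (component_subfunctorι_injective hU)

end

end Components

/-! ### The radical as a preradical of `Mod(C)` -/

section RadicalFunctor

variable {K : Type t} [Field K] {C : Type u} [Category.{v} C] [Preadditive C] [Linear K C]

/-- The definition only yields a left inverse `z`. But `z = 1 - z r` has the same form, so it has a
left inverse too, which makes `z` two-sided. -/
lemma isUnit_one_add_of_mem_jacobson {R : Type*} [Ring R] {r : R} (hr : r ∈ Ring.jacobson R) :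
    IsUnit (1 + r) := by
  have key : ∀ s ∈ Ring.jacobson R, ∃ z, z * (1 + s) = 1 := by
    intro s hs
    rw [← Ideal.jacobson_bot] at hs
    obtain ⟨z, hz⟩ := Ideal.exists_mul_add_sub_mem_of_mem_jacobson s hs
    rw [Submodule.mem_bot, sub_eq_zero] at hz
    exact ⟨z, by rw [add_comm]; exact hz⟩
  obtain ⟨z, hz⟩ := key r hr
  obtain ⟨z', hz'⟩ := key (-(z * r)) (neg_mem (Ideal.mul_mem_left _ z hr))
  have h : 1 + -(z * r) = z := by
    rw [mul_add, mul_one] at hz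
    rw [← hz]
    abel
  rw [h] at hz'
  have : z' = 1 + r := by
    calc z' = z' * (z * (1 + r)) := by rw [hz, mul_one]
      _ = 1 + r := by rw [← mul_assoc, hz', one_mul]
  exact ⟨⟨1 + r, z, by rw [← this, hz'], hz⟩, rfl⟩

lemma mem_jacobson_of_isUnit {R : Type*} [Ring R] {r : R} (h : ∀ x : R, IsUnit (1 + x * r)) :
    r ∈ Ring.jacobson R := by
  rw [← Ideal.jacobson_bot, Ideal.mem_jacobson_iff]
  intro y
  obtain ⟨u, hu⟩ := h y
  refine ⟨(u⁻¹ : Rˣ), ?_⟩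
  rw [Submodule.mem_bot, sub_eq_zero, mul_assoc]
  calc (↑u⁻¹ : R) * (y * r) + ↑u⁻¹ = ↑u⁻¹ * (1 + y * r) := by rw [mul_add, mul_one, add_comm]
    _ = 1 := by rw [← hu, Units.inv_mul]

/-- Jacobson's trick: if `v` inverts `1 + f ≫ g`, then `1 - g ≫ v ≫ f` inverts `1 + g ≫ f`. -/
lemma isUnit_one_add_comp {X Y : C} (f : X ⟶ Y) (g : Y ⟶ X)
    (h : IsUnit (1 + End.of (f ≫ g))) : IsUnit (1 + End.of (g ≫ f)) := by
  obtain ⟨⟨u, v, huv, hvu⟩, rfl : u = _⟩ := h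
  replace huv : v ≫ (𝟙 X + f ≫ g) = 𝟙 X := huv
  replace hvu : (𝟙 X + f ≫ g) ≫ v = 𝟙 X := hvu
  rw [Preadditive.comp_add, Category.comp_id] at huv
  rw [Preadditive.add_comp, Category.id_comp, Category.assoc] at hvu
  have h₁ : (𝟙 Y + g ≫ f) ≫ (𝟙 Y - g ≫ v ≫ f) = 𝟙 Y := by
    have : g ≫ f ≫ g ≫ v ≫ f = g ≫ f - g ≫ v ≫ f := by
      have := congrArg (fun k => g ≫ k ≫ f) hvu
      simp only [Preadditive.add_comp, Preadditive.comp_add, Category.assoc, Category.id_comp] at this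
      exact eq_sub_of_add_eq ((add_comm _ _).trans this)
    simp only [Preadditive.add_comp, Preadditive.comp_sub, Category.assoc, Category.comp_id,
      Category.id_comp, this]
    abel
  have h₂ : (𝟙 Y - g ≫ v ≫ f) ≫ (𝟙 Y + g ≫ f) = 𝟙 Y := by
    have : g ≫ v ≫ f ≫ g ≫ f = g ≫ f - g ≫ v ≫ f := by
      have := congrArg (fun k => g ≫ k ≫ f) huv
      simp only [Preadditive.add_comp, Preadditive.comp_add, Category.assoc, Category.id_comp] at this
      exact eq_sub_of_add_eq ((add_comm _ _).trans this)
    simp only [Preadditive.sub_comp, Preadditive.comp_add, Category.assoc, Category.comp_id,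
      Category.id_comp, this]
    abel
  exact ⟨⟨_, _, h₂, h₁⟩, rfl⟩

/-- The definition of the radical is one-sided, and this is its nontrivial side:
`isUnit_one_add_comp` moves the invertibility from `End Y` to `End X`. -/
lemma comp_mem_radical {X Y Z : C} (g : X ⟶ Y) {f : Y ⟶ Z} (hf : f ∈ radical K Y Z) :
    g ≫ f ∈ radical K X Z := by
  intro h
  refine mem_jacobson_of_isUnit fun x => ?_
  have h₁ := isUnit_one_add_of_mem_jacobson (hf (h ≫ x ≫ g))
  have h₂ := isUnit_one_add_comp (f ≫ h ≫ x) g (by simpa only [Category.assoc] using h₁)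
  rw [End.mul_def]
  simpa only [Category.assoc] using h₂

/-- The subspaces generated by the images of a family of subspaces under the radical. -/
def radicalSpan (F : FunctorMod.{v} K C) (U : ∀ X : C, Submodule K (F.obj.obj (op X))) (X : C) :
    Submodule K (F.obj.obj (op X)) :=
  ⨆ (Y : C) (f : radical K X Y), (U Y).map (action F f.1)

lemma action_mem_radicalSpan {F : FunctorMod.{v} K C} {U : ∀ X : C, Submodule K (F.obj.obj (op X))}
    {X Y : C} {f : X ⟶ Y} (hf : f ∈ radical K X Y) {y : F.obj.obj (op Y)} (hy : y ∈ U Y) :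
    action F f y ∈ radicalSpan F U X :=
  Submodule.mem_iSup_of_mem Y (Submodule.mem_iSup_of_mem ⟨f, hf⟩ ⟨y, hy, rfl⟩)

lemma radicalSpan_le {F : FunctorMod.{v} K C} {U : ∀ X : C, Submodule K (F.obj.obj (op X))}
    {X : C} {V : Submodule K (F.obj.obj (op X))}
    (h : ∀ (Y : C), ∀ f ∈ radical K X Y, ∀ y ∈ U Y, action F f y ∈ V) : radicalSpan F U X ≤ V :=
  iSup₂_le fun Y f => Submodule.map_le_iff_le_comap.2 fun y hy => h Y f.1 f.2 y hy

lemma isSubfunctor_radicalSpan (F : FunctorMod.{v} K C)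
    (U : ∀ X : C, Submodule K (F.obj.obj (op X))) : IsSubfunctor F (radicalSpan F U) := by
  intro X Y f
  change radicalSpan F U Y ≤ (radicalSpan F U X).comap (action F f)
  refine radicalSpan_le fun Z g hg z hz => ?_
  rw [Submodule.mem_comap, ← action_comp]
  exact action_mem_radicalSpan (comp_mem_radical f hg) hz

lemma radicalSub_zero {F : FunctorMod.{v} K C} {U : ∀ X : C, Submodule K (F.obj.obj (op X))}
    (hU : IsSubfunctor F U) : radicalSub F U 0 = U := by
  funext X
  refine le_antisymm (iSup₂_le fun Y f => ?_) ?_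
  · rintro _ ⟨y, hy, rfl⟩
    exact hU f.1 y hy
  · intro x hx
    exact Submodule.mem_iSup_of_mem X (Submodule.mem_iSup_of_mem ⟨𝟙 X, trivial⟩
      ⟨x, hx, action_id X x⟩)

/-- A morphism in `rad^(n+1)` is a sum of products of one in `rad^n` followed by one in `rad`; since
`F` is contravariant, the radical factor acts first. -/
lemma radicalSub_succ (F : FunctorMod.{v} K C) (U : ∀ X : C, Submodule K (F.obj.obj (op X)))
    (n : ℕ) : radicalSub F U (n + 1) = radicalSub F (radicalSpan F U) n := by
  funext X
  refine le_antisymm (iSup₂_le fun Y => ?_) (iSup₂_le fun Y g => ?_)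
  · rintro ⟨f, hf⟩ _ ⟨y, hy, rfl⟩
    change action F f y ∈ _
    change f ∈ Submodule.span K _ at hf
    induction hf using Submodule.span_induction with
    | mem f hf =>
      obtain ⟨A, g, h, hg, hh, rfl⟩ := hf
      rw [action_comp]
      exact Submodule.mem_iSup_of_mem A (Submodule.mem_iSup_of_mem ⟨g, hg⟩
        ⟨_, action_mem_radicalSpan hh hy, rfl⟩)
    | zero => rw [action_zero]; exact zero_mem _
    | add a b _ _ ha hb => rw [action_add]; exact add_mem ha hb
    | smul r a _ ha => rw [action_smul]; exact Submodule.smul_mem _ _ ha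
  · rw [Submodule.map_le_iff_le_comap]
    refine radicalSpan_le fun Z h hh z hz => ?_
    rw [Submodule.mem_comap, ← action_comp]
    exact Submodule.mem_iSup_of_mem Z (Submodule.mem_iSup_of_mem
      ⟨g.1 ≫ h, Submodule.subset_span ⟨Y, g.1, h, g.2, hh, rfl⟩⟩ ⟨z, hz, rfl⟩)

/-- Identifies powers of the ideal with iterates of the radical, so that the weak Koszul condition
can be read off the powers of the preradical. -/
lemma radicalSub_eq_iterate {F : FunctorMod.{v} K C}
    {U : ∀ X : C, Submodule K (F.obj.obj (op X))} (hU : IsSubfunctor F U) (n : ℕ) :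
    radicalSub F U n = (radicalSpan F)^[n] U := by
  induction n generalizing U with
  | zero => exact radicalSub_zero hU
  | succ n ih =>
    rw [radicalSub_succ, ih (isSubfunctor_radicalSpan F U), Function.iterate_succ_apply]

lemma map_radicalSpan {F G : FunctorMod.{v} K C} (η : F ⟶ G)
    (U : ∀ X : C, Submodule K (F.obj.obj (op X))) (X : C) :
    (radicalSpan F U X).map (component η X) =
      radicalSpan G (fun Y => (U Y).map (component η Y)) X := by
  rw [radicalSpan, radicalSpan, Submodule.map_iSup]
  refine iSup_congr fun Y => ?_
  rw [Submodule.map_iSup]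
  refine iSup_congr fun f => ?_
  rw [← Submodule.map_comp, ← Submodule.map_comp]
  congr 1
  exact LinearMap.ext fun y => component_action η f.1 y

lemma map_radicalSpan_iterate {F G : FunctorMod.{v} K C} (η : F ⟶ G)
    (U : ∀ X : C, Submodule K (F.obj.obj (op X))) (n : ℕ) (X : C) :
    ((radicalSpan F)^[n] U X).map (component η X) =
      (radicalSpan G)^[n] (fun Y => (U Y).map (component η Y)) X := by
  induction n generalizing U with
  | zero => rfl
  | succ n ih =>
    rw [Function.iterate_succ_apply, ih, Function.iterate_succ_apply]
    exact congrArg (fun V => (radicalSpan G)^[n] V X) (funext fun Y => map_radicalSpan η U Y)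

variable (K C) in
/-- The radical `rad F` of a functor `F` in `Mod(C)`. -/
def radicalObj (F : FunctorMod.{v} K C) : FunctorMod.{v} K C :=
  subfunctor (isSubfunctor_radicalSpan F fun _ => ⊤)

/-- The inclusion of the radical. -/
def radicalι (F : FunctorMod.{v} K C) : radicalObj K C F ⟶ F :=
  subfunctorι (isSubfunctor_radicalSpan F fun _ => ⊤)

lemma range_radicalι (F : FunctorMod.{v} K C) (X : C) :
    LinearMap.range (component (radicalι F) X) = radicalSpan F (fun _ => ⊤) X :=
  range_subfunctorι _ X

instance (F : FunctorMod.{v} K C) : Mono (radicalι F) :=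
  inferInstanceAs (Mono (subfunctorι _))

lemma exists_radicalMap {F G : FunctorMod.{v} K C} (η : F ⟶ G) :
    ∃ θ : radicalObj K C F ⟶ radicalObj K C G, θ ≫ radicalι G = radicalι F ≫ η := by
  refine exists_lift_of_range_le (radicalι G) (radicalι F ≫ η) fun X => ?_
  rw [component_comp', LinearMap.range_comp, range_radicalι, range_radicalι, map_radicalSpan]
  exact radicalSpan_le fun Y f hf y _ => action_mem_radicalSpan hf trivial

variable (K C) in
/-- The radical, as a preradical of `Mod(C)` which preserves epimorphisms. -/
noncomputable def radicalPreradical : EpiPreradical (FunctorMod.{v} K C) where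
  functor :=
    { obj F := radicalObj K C F
      map η := (exists_radicalMap η).choose
      map_id F := by
        rw [← cancel_mono (radicalι F), (exists_radicalMap (𝟙 F)).choose_spec, Category.comp_id,
          Category.id_comp]
      map_comp {F G H} η θ := by
        rw [← cancel_mono (radicalι H), (exists_radicalMap (η ≫ θ)).choose_spec, Category.assoc,
          (exists_radicalMap θ).choose_spec, ← Category.assoc, ← Category.assoc,
          (exists_radicalMap η).choose_spec] }
  ι F := radicalι F
  map_ι η := (exists_radicalMap η).choose_spec
  mono_ι F := inferInstance
  epi_map {F G} η _ := by
    -- The radical is a sum of images under radical morphisms, so its image under `η` is generated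
    -- in the same way by the image of `η`, which is everything.
    refine epi_of_surjective _ fun X x => ?_
    have h : component (radicalι G) X x ∈ (radicalSpan F (fun _ => ⊤) X).map (component η X) := by
      rw [map_radicalSpan]
      have : (fun Y => (⊤ : Submodule K (F.obj.obj (op Y))).map (component η Y)) = fun _ => ⊤ := by
        funext Y
        rw [Submodule.map_top, LinearMap.range_eq_top]
        exact component_surjective η Y
      rw [this, ← range_radicalι]
      exact ⟨x, rfl⟩
    obtain ⟨y, hy, hyx⟩ := h
    rw [← range_radicalι] at hy
    obtain ⟨y, rfl⟩ := hy
    refine ⟨y, component_injective (radicalι G) X ?_⟩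
    rw [← hyx, ← component_comp, ← component_comp, ← (exists_radicalMap η).choose_spec]

lemma range_powι (F : FunctorMod.{v} K C) (k : ℕ) (X : C) :
    LinearMap.range (component ((radicalPreradical K C).powι k F) X) =
      (radicalSpan F)^[k] (fun _ => ⊤) X := by
  induction k generalizing X with
  | zero => exact LinearMap.range_eq_top.2 Function.surjective_id
  | succ k ih =>
    rw [EpiPreradical.powι_succ, component_comp', LinearMap.range_comp,
      Function.iterate_succ_apply']
    refine (congrArg (Submodule.map _) (range_radicalι _ X)).trans ?_
    rw [map_radicalSpan]
    congr 1
    funext Y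
    rw [Submodule.map_top, ih]

end RadicalFunctor

/-! ### Finite direct sums of simple objects -/

section Semisimple

variable {A : Type u} [Category.{v} A] [Abelian A]

/-- An object is semisimple of finite length if it is a finite direct sum of simple objects. -/
def IsFiniteSumOfSimple [HasFiniteBiproducts A] (F : A) : Prop :=
  ∃ (n : ℕ) (S : Fin n → A), (∀ i, Simple (S i)) ∧ Nonempty (F ≅ ⨁ S)

namespace IsFiniteSumOfSimple

variable [HasFiniteBiproducts A]

lemma of_finite {J : Type} [Finite J] {F : A} (S : J → A) (hS : ∀ j, Simple (S j))
    (e : F ≅ ⨁ S) : IsFiniteSumOfSimple F := by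
  obtain ⟨n, ⟨φ⟩⟩ := Finite.exists_equiv_fin J
  exact ⟨n, S ∘ φ.symm, fun i => hS _, ⟨e ≪≫ (biproduct.reindex φ.symm S).symm⟩⟩

lemma of_isZero {F : A} (h : IsZero F) : IsFiniteSumOfSimple F :=
  ⟨0, fun i => i.elim0, fun i => i.elim0, ⟨h.iso (by
    rw [IsZero.iff_id_eq_zero]
    ext i
    exact i.elim0)⟩⟩

lemma of_simple (F : A) [Simple F] : IsFiniteSumOfSimple F :=
  of_finite (fun _ : Unit => F) (fun _ => ‹_›) (biproductUniqueIso fun _ : Unit => F).symm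

lemma biproduct {J : Type} [Finite J] (F : J → A) (h : ∀ j, IsFiniteSumOfSimple (F j)) :
    IsFiniteSumOfSimple (⨁ F) := by
  choose n S hS e using h
  exact of_finite (J := Σ j, Fin (n j)) (fun p => S p.1 p.2) (fun p => hS p.1 p.2)
    (biproduct.mapIso (fun j => (e j).some) ≪≫ biproductBiproductIso _ _)

lemma of_splitting {S : ShortComplex A} (σ : S.Splitting) (h₁ : IsFiniteSumOfSimple S.X₁)
    [Simple S.X₃] : IsFiniteSumOfSimple S.X₂ := by
  obtain ⟨n, T, hT, ⟨e⟩⟩ := h₁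
  let T' : Option (Fin n) → A := fun o => match o with
    | none => S.X₃
    | some j => T j
  let a : ∀ o, S.X₂ ⟶ T' o := fun o => match o with
    | none => S.g
    | some j => σ.r ≫ e.hom ≫ biproduct.π T j
  let b : ∀ o, T' o ⟶ S.X₂ := fun o => match o with
    | none => σ.s
    | some j => biproduct.ι T j ≫ e.inv ≫ S.f
  have hab : ∑ o, a o ≫ b o = 𝟙 _ := by
    rw [Fintype.sum_option]
    change S.g ≫ σ.s + ∑ j, (σ.r ≫ e.hom ≫ biproduct.π T j) ≫ biproduct.ι T j ≫ e.inv ≫ S.f = _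
    have : ∑ j, (σ.r ≫ e.hom ≫ biproduct.π T j) ≫ biproduct.ι T j ≫ e.inv ≫ S.f =
        σ.r ≫ e.hom ≫ (∑ j, biproduct.π T j ≫ biproduct.ι T j) ≫ e.inv ≫ S.f := by
      simp only [Preadditive.comp_sum, Preadditive.sum_comp, Category.assoc]
    rw [this, biproduct.total, Category.id_comp, e.hom_inv_id_assoc, add_comm, σ.id]
  have hbb : ∀ o, b o ≫ a o = 𝟙 _ := by
    rintro (_ | j)
    · exact σ.s_g
    · change (biproduct.ι T j ≫ e.inv ≫ S.f) ≫ σ.r ≫ e.hom ≫ biproduct.π T j = _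
      simp only [Category.assoc, reassoc_of% σ.f_r, e.inv_hom_id_assoc, biproduct.ι_π_self]
      rfl
  have hba : ∀ o o', o ≠ o' → b o ≫ a o' = 0 := by
    rintro (_ | j) (_ | j') h
    · exact absurd rfl h
    · change σ.s ≫ σ.r ≫ e.hom ≫ biproduct.π T j' = 0
      rw [reassoc_of% σ.s_r, zero_comp]
    · change (biproduct.ι T j ≫ e.inv ≫ S.f) ≫ S.g = 0
      simp only [Category.assoc, S.zero, comp_zero]
    · change (biproduct.ι T j ≫ e.inv ≫ S.f) ≫ σ.r ≫ e.hom ≫ biproduct.π T j' = _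
      have : j ≠ j' := fun h' => h (by rw [h'])
      simp only [Category.assoc, reassoc_of% σ.f_r, e.inv_hom_id_assoc, biproduct.ι_π_ne _ this]
  refine of_finite T' ?_ ⟨biproduct.lift a, biproduct.desc b, ?_, ?_⟩
  · rintro (_ | j)
    · assumption
    · exact hT j
  · rw [biproduct.lift_desc, hab]
  · refine biproduct.hom_ext' _ _ fun o => biproduct.hom_ext _ _ fun o' => ?_
    rw [biproduct.ι_desc_assoc, Category.assoc, biproduct.lift_π, Category.comp_id]
    by_cases h : o = o'
    · subst h
      rw [hbb, biproduct.ι_π_self]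
    · rw [hba _ _ h, biproduct.ι_π_ne _ h]

/-- Induction on the length of a finite direct sum of simple objects. -/
lemma induction {p : A → Prop} (zero : ∀ Z, IsZero Z → p Z)
    (split : ∀ (S : ShortComplex A), S.Splitting → Simple S.X₃ → p S.X₁ → p S.X₂) {F : A}
    (hF : IsFiniteSumOfSimple F) : p F := by
  obtain ⟨n, T, hT, ⟨e⟩⟩ := hF
  induction n generalizing F with
  | zero =>
    refine zero F ?_
    rw [IsZero.iff_id_eq_zero, ← cancel_mono e.hom]
    ext i
    exact i.elim0
  | succ n ih =>
    let T' : Fin n → A := fun j => T j.castSucc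
    have hi : biproduct.desc (fun j : Fin n => biproduct.ι T j.castSucc) ≫
        biproduct.lift (fun j : Fin n => biproduct.π T j.castSucc) = 𝟙 (⨁ T') := by
      refine biproduct.hom_ext' _ _ fun j => biproduct.hom_ext _ _ fun j' => ?_
      rw [biproduct.ι_desc_assoc, Category.assoc, biproduct.lift_π, Category.comp_id]
      by_cases h : j = j'
      · subst h
        rw [biproduct.ι_π_self, biproduct.ι_π_self]
      · rw [biproduct.ι_π_ne _ h, biproduct.ι_π_ne _ (fun h' => h (Fin.castSucc_injective _ h'))]
    have hz : biproduct.desc (fun j : Fin n => biproduct.ι T j.castSucc) ≫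
        biproduct.π T (Fin.last n) = (0 : ⨁ T' ⟶ _) := by
      refine biproduct.hom_ext' _ _ fun j => ?_
      rw [biproduct.ι_desc_assoc, biproduct.ι_π_ne _ (Fin.castSucc_lt_last j).ne, comp_zero]
    refine split (ShortComplex.mk (biproduct.desc (fun j : Fin n => biproduct.ι T j.castSucc) ≫ e.inv)
      (e.hom ≫ biproduct.π T (Fin.last n)) (by rw [Category.assoc, e.inv_hom_id_assoc, hz]))
      { r := e.hom ≫ biproduct.lift (fun j : Fin n => biproduct.π T j.castSucc)
        s := biproduct.ι T (Fin.last n) ≫ e.inv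
        f_r := ?_, s_g := ?_, id := ?_ } (hT _) (ih T' (fun j => hT _) (Iso.refl _))
    · exact (Category.assoc _ _ _).trans ((congrArg _ (e.inv_hom_id_assoc _)).trans hi)
    · exact (Category.assoc _ _ _).trans ((congrArg _ (e.inv_hom_id_assoc _)).trans
        (biproduct.ι_π_self T (Fin.last n)))
    · have h₁ : biproduct.lift (fun j : Fin n => biproduct.π T j.castSucc) ≫
          biproduct.desc (fun j : Fin n => biproduct.ι T j.castSucc) +
          biproduct.π T (Fin.last n) ≫ biproduct.ι T (Fin.last n) = 𝟙 _ := by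
        rw [biproduct.lift_desc, ← biproduct.total, Fin.sum_univ_castSucc]
      have h₂ := congrArg (fun k => e.hom ≫ k ≫ e.inv) h₁
      simpa only [Preadditive.add_comp, Preadditive.comp_add, Category.assoc, Category.id_comp,
        e.hom_inv_id] using h₂

/-- Induction on length. A subobject `H` of `X₁ ⊕ X₃`, with `X₃` simple, either maps to zero in `X₃`
and lies in `X₁`, or maps onto `X₃`. -/
lemma splitsSubobjects {F : A} (hF : IsFiniteSumOfSimple F) : SplitsSubobjects F := by
  refine hF.induction (fun Z hZ => ?_) (fun S σ _ ih => ?_)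
  · intro H m _
    exact ⟨0, by rw [← cancel_mono m]; exact hZ.eq_of_tgt _ _⟩
  · intro H m _
    have hm : m = m ≫ σ.r ≫ S.f + m ≫ S.g ≫ σ.s := by
      rw [← Preadditive.comp_add, σ.id, Category.comp_id]
    by_cases hg : m ≫ S.g = 0
    · have h : (m ≫ σ.r) ≫ S.f = m := by
        rw [reassoc_of% hg, zero_comp, add_zero] at hm
        rw [Category.assoc, ← hm]
      have : Mono ((m ≫ σ.r) ≫ S.f) := by rwa [h]
      have := mono_of_mono (m ≫ σ.r) S.f
      obtain ⟨t, ht⟩ := ih (m ≫ σ.r)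
      exact ⟨σ.r ≫ t, by rw [← Category.assoc, ht]⟩
    · have hepi : Epi (m ≫ S.g) := epi_of_nonzero_to_simple hg
      let k := kernel.ι (m ≫ S.g)
      have hk : k ≫ m ≫ S.g = 0 := kernel.condition _
      have h : (k ≫ m ≫ σ.r) ≫ S.f = k ≫ m := by
        have h := congrArg (fun f => k ≫ f) hm
        rw [Preadditive.comp_add, reassoc_of% hk, zero_comp, add_zero] at h
        rw [Category.assoc, Category.assoc, ← h]
      have : Mono ((k ≫ m ≫ σ.r) ≫ S.f) := by
        rw [h]
        exact mono_comp k m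
      have := mono_of_mono (k ≫ m ≫ σ.r) S.f
      obtain ⟨t, ht⟩ := ih (k ≫ m ≫ σ.r)
      -- The kernel of `H ⟶ X₃` embeds in `X₁` and splits off there, so it splits off from `H`. The
      -- retraction onto `H` combines that one with the section `τ.s` of `H ⟶ X₃`.
      let τ := ShortComplex.Splitting.ofExactOfRetraction (ShortComplex.mk _ _ hk)
        (ShortComplex.exact_kernel _) (m ≫ σ.r ≫ t) (by
          simpa only [Category.assoc] using ht) hepi
      refine ⟨σ.r ≫ t ≫ k + S.g ≫ τ.s, ?_⟩
      have hτ : (m ≫ σ.r ≫ t) ≫ k + (m ≫ S.g) ≫ τ.s = 𝟙 _ := τ.id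
      rw [← hτ]
      simp only [Preadditive.comp_add, Category.assoc]

/-- Compare `Q` with the image of `X₁`: the cokernel `c` of `X₁ ⟶ Q` is a quotient of the simple
`X₃`, hence zero or isomorphic to it. In the second case the inclusion of `X₃` in `F` provides a
section of `c`. -/
lemma of_epi {F Q : A} (hF : IsFiniteSumOfSimple F) (f : F ⟶ Q) [Epi f] :
    IsFiniteSumOfSimple Q := by
  suffices h : ∀ Q (f : F ⟶ Q) [Epi f], IsFiniteSumOfSimple Q from h Q f
  refine hF.induction (p := fun F => ∀ Q (f : F ⟶ Q) [Epi f], IsFiniteSumOfSimple Q)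
    (fun Z hZ Q f _ => of_isZero (IsZero.of_epi f hZ)) (fun S σ _ ih Q f _ => ?_)
  let c := cokernel.π (S.f ≫ f)
  have hc : S.f ≫ f ≫ c = 0 := by
    rw [← Category.assoc]
    exact cokernel.condition _
  have hfc : f ≫ c = S.g ≫ σ.s ≫ f ≫ c := by
    conv_lhs => rw [← Category.id_comp (f ≫ c), ← σ.id, Preadditive.add_comp, Category.assoc, hc,
      comp_zero, zero_add, Category.assoc]
  by_cases h : σ.s ≫ f ≫ c = 0
  · rw [h, comp_zero] at hfc
    have hc0 : c = 0 := by rwa [← cancel_epi f, comp_zero]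
    have : Epi (S.f ≫ f) := Preadditive.epi_of_cokernel_zero hc0
    exact ih Q (S.f ≫ f)
  · have : Epi (S.g ≫ σ.s ≫ f ≫ c) := by
      rw [← hfc]
      exact epi_comp f c
    have := epi_of_epi S.g (σ.s ≫ f ≫ c)
    have := isIso_of_epi_of_nonzero h
    have := Simple.of_iso (asIso (σ.s ≫ f ≫ c)).symm
    let τ := ShortComplex.Splitting.ofExactOfSection (ShortComplex.mk _ _ (kernel.condition c))
      (ShortComplex.exact_kernel c) (inv (σ.s ≫ f ≫ c) ≫ σ.s ≫ f) (by
        simp only [Category.assoc]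
        rw [IsIso.inv_hom_id]) (inferInstanceAs (Mono (kernel.ι c)))
    have h₁ := ih (Abelian.image (S.f ≫ f)) (Abelian.factorThruImage (S.f ≫ f))
    exact of_splitting τ h₁

end IsFiniteSumOfSimple

end Semisimple

/-! ### Representable functors, simple functors and their radicals -/

section Simple

variable {K : Type t} [Field K] {C : Type u} [Category.{v} C] [Preadditive C] [Linear K C]

variable (K) in
/-- The morphism of representable functors given by a morphism of `C`. -/
def representableMap {X Y : C} (f : X ⟶ Y) : representable K X ⟶ representable K Y :=
  ObjectProperty.homMk ((linearYoneda K C).map f)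

lemma action_representable {X Y Z : C} (f : X ⟶ Y) (g : Y ⟶ Z) :
    action (representable K Z) f g = f ≫ g := rfl

/-- The morphism from a representable functor given by an element. -/
def ofElement (F : FunctorMod.{v} K C) {X : C} (x : F.obj.obj (op X)) : representable K X ⟶ F :=
  ObjectProperty.homMk
    { app Y := ModuleCat.ofHom
        { toFun := fun g : Y.unop ⟶ X => action F g x
          map_add' := fun g g' => action_add g g' x
          map_smul' := fun r g => action_smul r g x }
      naturality Y Z f := by
        refine ModuleCat.hom_ext (LinearMap.ext fun g => ?_)
        exact action_comp (F := F) f.unop g x }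

/-- The value at a morphism of `C` of a morphism from a representable functor. -/
def value {F : FunctorMod.{v} K C} {X : C} (f : representable K X ⟶ F) {Y : C} (g : Y ⟶ X) :
    F.obj.obj (op Y) :=
  component f Y g

lemma value_zero {F : FunctorMod.{v} K C} {X Y : C} (g : Y ⟶ X) :
    value (0 : representable K X ⟶ F) g = 0 := rfl

lemma value_comp {F : FunctorMod.{v} K C} {X Y Z : C} (f : representable K X ⟶ F) (h : Z ⟶ Y)
    (g : Y ⟶ X) : value f (h ≫ g) = action F h (value f g) :=
  component_action f h g

lemma value_ofElement {F : FunctorMod.{v} K C} {X : C} (x : F.obj.obj (op X)) {Y : C}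
    (g : Y ⟶ X) : value (ofElement F x) g = action F g x := rfl

lemma ofElement_ne_zero {F : FunctorMod.{v} K C} {X : C} {x : F.obj.obj (op X)} (hx : x ≠ 0) :
    ofElement F x ≠ 0 := by
  intro h
  refine hx ?_
  rw [← action_id X x, ← value_ofElement, h, value_zero]

lemma hom_eq_ofElement {F : FunctorMod.{v} K C} {X : C} (f : representable K X ⟶ F) :
    f = ofElement F (value f (𝟙 X)) :=
  functorMod_hom_ext fun _ g => (congrArg (value f) (Category.comp_id g)).symm.trans
    (value_comp f g (𝟙 X))

instance projective_representable (X : C) : Projective (representable K X) where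
  factors {E F} f e _ := by
    obtain ⟨y, hy⟩ := component_surjective e X (value f (𝟙 X))
    refine ⟨ofElement E y, functorMod_hom_ext fun Y g => ?_⟩
    rw [hom_eq_ofElement f, ← hy, component_comp]
    exact component_action e g y

lemma radical_comp_mem {X Y Z : C} {f : X ⟶ Y} (hf : f ∈ radical K X Y) (g : Y ⟶ Z) :
    f ≫ g ∈ radical K X Z := by
  intro h
  rw [Category.assoc]
  exact hf (g ≫ h)

lemma exists_ne_zero_of_simple (S : FunctorMod.{v} K C) [Simple S] :
    ∃ (X : C) (x : S.obj.obj (op X)), x ≠ 0 := by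
  by_contra! h
  exact id_nonzero S (functorMod_hom_ext fun X x => by rw [component_id, h X x, map_zero])

/-- Nakayama: if `rad S = S`, a generator `s` satisfies `s = r s` with `r` in the radical of `End
X`; as `1 - r` is invertible, `s = 0`. -/
lemma radicalι_of_simple (S : FunctorMod.{v} K C) [Simple S] : radicalι S = 0 := by
  by_contra h
  have := isIso_of_mono_of_nonzero h
  obtain ⟨X, s, hs⟩ := exists_ne_zero_of_simple S
  have : Epi (ofElement S s) := epi_of_nonzero_to_simple (ofElement_ne_zero hs)
  have hle : radicalSpan S (fun _ => ⊤) X ≤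
      Submodule.map (component (ofElement S s) X) (radical K X X) := by
    refine radicalSpan_le fun Y f hf y _ => ?_
    obtain ⟨g, rfl⟩ := component_surjective (ofElement S s) Y y
    refine ⟨f ≫ g, radical_comp_mem hf g, ?_⟩
    exact (component_action (ofElement S s) f g).symm ▸ rfl
  obtain ⟨x, hx⟩ := component_surjective (radicalι S) X s
  obtain ⟨r : X ⟶ X, hr : r ∈ radical K X X, hrs⟩ := hle (by rw [← range_radicalι]; exact ⟨x, hx⟩)
  replace hrs : action S r s = s := hrs
  obtain ⟨⟨u : X ⟶ X, v : X ⟶ X, huv, hvu⟩, hu⟩ :=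
    isUnit_one_add_of_mem_jacobson (neg_mem (hr (𝟙 X)))
  replace hu : u = 𝟙 X + -(r ≫ 𝟙 X) := hu
  replace hvu : u ≫ v = 𝟙 X := hvu
  replace huv : v ≫ u = 𝟙 X := huv
  refine hs ?_
  have h₀ : action S u s = 0 := by
    have h₁ : u + r = 𝟙 X := by
      rw [hu, Category.comp_id]
      abel
    have h₂ := congrArg (fun f => action S f s) h₁
    rw [action_add, hrs, action_id] at h₂
    exact add_eq_right.1 h₂
  have := action_comp v u s
  rwa [h₀, map_zero, huv, action_id] at this

lemma radicalι_of_isFiniteSumOfSimple {F : FunctorMod.{v} K C} (hF : IsFiniteSumOfSimple F) :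
    radicalι F = 0 := by
  refine hF.induction (p := fun F => (radicalPreradical K C).ι F = 0)
    (fun Z hZ => hZ.eq_of_tgt _ _) (fun S σ h₃ h₁ => ?_)
  have h₃ : (radicalPreradical K C).ι S.X₃ = 0 := radicalι_of_simple S.X₃
  rw [← Category.comp_id ((radicalPreradical K C).ι S.X₂), ← σ.id, Preadditive.comp_add,
    ← Category.assoc, ← Category.assoc, ← EpiPreradical.map_ι, ← EpiPreradical.map_ι, h₁, h₃]
  simp only [comp_zero, zero_comp, add_zero]

/-- Modulo the radical every nonzero element generates: if `g : W ⟶ X` is not radical, locality of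
`End X` provides `b` with `b ≫ g` invertible, so the class of `𝟙 X` is a multiple of that of `g`. -/
lemma simple_top_representable (X : C) [IsLocalRing (End X)] :
    Simple ((radicalPreradical K C).top (representable K X)) := by
  set ρ := radicalPreradical K C
  set π := ρ.topπ (representable K X)
  have hex := exact_component (ρ.top_shortExact (representable K X)).exact
  have hrad : ∀ {W : C} (g : W ⟶ X), g ∈ radical K W X → component π W g = 0 := by
    intro W g hg
    refine (hex W g).2 ?_
    have : g ∈ LinearMap.range (component (radicalι (representable K X)) W) := by
      rw [range_radicalι]
      have := action_mem_radicalSpan (F := representable K X) (U := fun _ => ⊤) hg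
        (y := 𝟙 X) trivial
      rwa [action_representable, Category.comp_id] at this
    exact this
  have hJ : End.of (𝟙 X) ∉ Ring.jacobson (End X) := by
    intro h
    have := isUnit_one_add_of_mem_jacobson (neg_mem h)
    rw [show (1 + -End.of (𝟙 X) : End X) = 0 from add_neg_cancel (1 : End X)] at this
    exact not_isUnit_zero this
  refine simple_of_cosimple _ fun {Z} f _ => ⟨fun hf h0 => ?_, fun hf => ?_⟩
  · have hπ : π = 0 := by
      rw [← cancel_mono f, h0, comp_zero, comp_zero]
    obtain ⟨x, hx⟩ := (hex X (𝟙 X)).1 (by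
      change value π (𝟙 X) = 0
      rw [hπ, value_zero])
    have hmem : (𝟙 X : X ⟶ X) ∈ radicalSpan (representable K X) (fun _ => ⊤) X := by
      rw [← range_radicalι]
      exact ⟨x, hx⟩
    have hle : radicalSpan (representable K X) (fun _ => ⊤) X ≤ radical K X X :=
      radicalSpan_le fun Y g hg y _ => radical_comp_mem hg y
    refine hJ ?_
    have := hle hmem (𝟙 X)
    rwa [Category.comp_id] at this
  · have hmono : Mono f := by
      refine mono_of_injective f fun W => ?_
      rw [injective_iff_map_eq_zero]
      intro t ht
      obtain ⟨g, rfl⟩ : ∃ g : W ⟶ X, value π g = t := component_surjective π W t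
      refine hrad g ?_
      by_contra hg
      obtain ⟨b, hb⟩ : ∃ b : X ⟶ W, ¬ IsUnit (1 + End.of (g ≫ b)) := by
        by_contra! h
        refine hg fun b => mem_jacobson_of_isUnit fun x => ?_
        have := h (b ≫ x)
        rwa [← Category.assoc] at this
      have hb' : ¬ IsUnit (1 + End.of (b ≫ g)) := fun h => hb (isUnit_one_add_comp b g h)
      have hu : IsUnit (End.of (b ≫ g)) := by
        have : (1 + End.of (b ≫ g)) + -End.of (b ≫ g) = 1 := add_neg_cancel_right _ _
        exact IsUnit.neg_iff _ |>.1
          ((IsLocalRing.isUnit_or_isUnit_of_add_one this).resolve_left hb')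
      obtain ⟨⟨u, v, huv, hvu⟩, hu⟩ := hu
      replace hu : u = b ≫ g := hu
      replace huv : v ≫ u = 𝟙 X := huv
      -- `𝟙 X` factors through `g`, whose class `f` kills; then `f` kills the generator and is zero.
      have h₁ : value (π ≫ f) (𝟙 X) = 0 := by
        have h₂ : value (π ≫ f) g = 0 := ht
        rw [← huv, hu, ← Category.assoc, value_comp, h₂, map_zero]
      have h₂ : π ≫ f = 0 := by
        rw [hom_eq_ofElement (π ≫ f), h₁]
        exact functorMod_hom_ext fun Y g => map_zero (action Z g)
      exact hf (by rwa [← cancel_epi π, comp_zero])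
    exact isIso_of_mono_of_epi f

end Simple

/-! ### Finitely generated functors over a Krull-Schmidt category -/

section FinitelyGenerated

variable {K : Type t} [Field K] {C : Type u} [Category.{v} C] [Preadditive C] [Linear K C]

namespace IsFinitelyGenerated

lemma of_epi {F G : FunctorMod.{v} K C} (hF : IsFinitelyGenerated F) (f : F ⟶ G) [Epi f] :
    IsFinitelyGenerated G := by
  obtain ⟨X, p, _⟩ := hF
  exact ⟨X, p ≫ f, epi_comp p f⟩

lemma representable (X : C) : IsFinitelyGenerated (representable K X) := ⟨X, 𝟙 _, inferInstance⟩

lemma of_sum [HasFiniteBiproducts C] {G : FunctorMod.{v} K C} {J : Type} [Fintype J]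
    {Y : J → FunctorMod.{v} K C} (p : ∀ j, G ⟶ Y j) (s : ∀ j, Y j ⟶ G)
    (hps : ∑ j, p j ≫ s j = 𝟙 G) (h : ∀ j, IsFinitelyGenerated (Y j)) :
    IsFinitelyGenerated G := by
  choose X q hq using h
  refine ⟨⨁ X, ∑ j, representableMap K (biproduct.π X j) ≫ q j ≫ s j,
    epi_of_surjective _ fun W x => ?_⟩
  choose y hy using fun j => component_surjective (q j) W (component (p j) W x)
  let z : (KoszulCat.representable K (⨁ X)).obj.obj (op W) := biproduct.lift (f := X) y
  have hz : ∀ j, component (representableMap K (biproduct.π X j)) W z = y j := fun j =>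
    biproduct.lift_π (f := X) y j
  refine ⟨z, ?_⟩
  rw [component_sum]
  have hx := congrArg (fun η => component η W x) hps
  refine Eq.trans ?_ hx
  refine Eq.trans (Finset.sum_congr rfl fun j _ => ?_) (component_sum _ _ W x).symm
  rw [component_comp, component_comp, component_comp, ← hy j, hz]

lemma of_add [HasFiniteBiproducts C] {G Y₁ Y₂ : FunctorMod.{v} K C} (p₁ : G ⟶ Y₁) (s₁ : Y₁ ⟶ G)
    (p₂ : G ⟶ Y₂) (s₂ : Y₂ ⟶ G) (hps : p₁ ≫ s₁ + p₂ ≫ s₂ = 𝟙 G) (h₁ : IsFinitelyGenerated Y₁)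
    (h₂ : IsFinitelyGenerated Y₂) : IsFinitelyGenerated G :=
  of_sum (J := Bool) (Y := fun b => bif b then Y₁ else Y₂)
    (fun b => match b with | true => p₁ | false => p₂)
    (fun b => match b with | true => s₁ | false => s₂) (by simpa using hps)
    (fun b => match b with | true => h₁ | false => h₂)

end IsFinitelyGenerated

lemma representableMap_comp {X Y Z : C} (f : X ⟶ Y) (g : Y ⟶ Z) :
    representableMap K (f ≫ g) = representableMap K f ≫ representableMap K g :=
  functorMod_hom_ext fun _ h => (Category.assoc h f g).symm

lemma representableMap_id (X : C) : representableMap K (𝟙 X) = 𝟙 _ :=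
  functorMod_hom_ext fun _ h => Category.comp_id h

lemma representableMap_sum {X Y : C} {J : Type*} (s : Finset J) (f : J → (X ⟶ Y)) :
    representableMap K (∑ j ∈ s, f j) = ∑ j ∈ s, representableMap K (f j) :=
  functorMod_hom_ext fun W h => (Preadditive.comp_sum s h f).trans
    (component_sum s (fun j => representableMap K (f j)) W h).symm

variable [HasFiniteBiproducts C]

lemma exists_representable_decomposition (hC : IsKrullSchmidt C) (X : C) :
    ∃ (n : ℕ) (Y : Fin n → C) (p : ∀ i, representable K X ⟶ representable K (Y i))
      (s : ∀ i, representable K (Y i) ⟶ representable K X),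
      (∀ i, IsLocalRing (End (Y i))) ∧ ∑ i, p i ≫ s i = 𝟙 _ := by
  obtain ⟨n, Y, hY, ⟨e⟩⟩ := hC X
  refine ⟨n, Y, fun i => representableMap K (e.hom ≫ biproduct.π Y i),
    fun i => representableMap K (biproduct.ι Y i ≫ e.inv), hY, ?_⟩
  simp only [← representableMap_comp, ← representableMap_sum]
  have : ∑ i, (e.hom ≫ biproduct.π Y i) ≫ biproduct.ι Y i ≫ e.inv =
      e.hom ≫ (∑ i, biproduct.π Y i ≫ biproduct.ι Y i) ≫ e.inv := by
    simp only [Preadditive.comp_sum, Preadditive.sum_comp, Category.assoc]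
  rw [this, biproduct.total, Category.id_comp, e.hom_inv_id, representableMap_id]

/-- A cover of `G` by `Hom(-, X)` makes `top G` a quotient of the sum of the simple tops attached to
the indecomposable summands of `X`. -/
lemma isFiniteSumOfSimple_top (hC : IsKrullSchmidt C) {G : FunctorMod.{v} K C}
    (hG : IsFinitelyGenerated G) : IsFiniteSumOfSimple ((radicalPreradical K C).top G) := by
  obtain ⟨X, q, _⟩ := hG
  obtain ⟨n, Y, p, s, hY, hps⟩ := exists_representable_decomposition (K := K) hC X
  set ρ := radicalPreradical K C
  let f : ∀ i, ρ.top (representable K (Y i)) ⟶ ρ.top G := fun i =>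
    cokernel.desc (ρ.ι _) (s i ≫ q ≫ ρ.topπ G) (by
      have := ρ.map_ι (s i ≫ q)
      rw [← Category.assoc (s i), ← Category.assoc, ← this, Category.assoc, ρ.ι_topπ, comp_zero])
  have hf : ∀ i, ρ.topπ _ ≫ f i = s i ≫ q ≫ ρ.topπ G := fun i => cokernel.π_desc _ _ _
  have hsimple : ∀ i, Simple (ρ.top (representable K (Y i))) := fun i =>
    have := hY i
    simple_top_representable (Y i)
  have hsum : biproduct.lift (fun i => p i ≫ ρ.topπ _) ≫ biproduct.desc f = q ≫ ρ.topπ G := by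
    rw [biproduct.lift_desc]
    have : ∑ i, (p i ≫ ρ.topπ _) ≫ f i = (∑ i, p i ≫ s i) ≫ q ≫ ρ.topπ G := by
      simp only [Preadditive.sum_comp, Category.assoc, hf]
    rw [this, hps, Category.id_comp]
  have : Epi (biproduct.lift (fun i => p i ≫ ρ.topπ _) ≫ biproduct.desc f) := by
    rw [hsum]
    exact epi_comp q (ρ.topπ G)
  have := epi_of_epi (biproduct.lift (fun i => p i ≫ ρ.topπ _)) (biproduct.desc f)
  exact (IsFiniteSumOfSimple.biproduct (fun i => ρ.top (representable K (Y i))) fun i =>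
    IsFiniteSumOfSimple.of_simple _).of_epi (biproduct.desc f)

/-- `P` is a retract of a representable functor. Splitting idempotents in `C` is not needed: a
decomposition of the identity of `P` is enough for the vanishing statement. -/
lemma projective_decomposition (hC : IsKrullSchmidt C) {P : FunctorMod.{v} K C} [Projective P]
    (hP : IsFinitelyGenerated P) : ∃ (n : ℕ) (Y : Fin n → C)
      (p : ∀ i, P ⟶ representable K (Y i)) (s : ∀ i, representable K (Y i) ⟶ P),
      (∀ i, IsLocalRing (End (Y i))) ∧ ∑ i, p i ≫ s i = 𝟙 P := by
  obtain ⟨X, q, _⟩ := hP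
  obtain ⟨n, Y, p, s, hY, hps⟩ := exists_representable_decomposition (K := K) hC X
  refine ⟨n, Y, fun i => Projective.factorThru (𝟙 P) q ≫ p i, fun i => s i ≫ q, hY, ?_⟩
  have : ∑ i, (Projective.factorThru (𝟙 P) q ≫ p i) ≫ s i ≫ q =
      Projective.factorThru (𝟙 P) q ≫ (∑ i, p i ≫ s i) ≫ q := by
    simp only [Preadditive.comp_sum, Preadditive.sum_comp, Category.assoc]
  rw [this, hps, Category.id_comp, Projective.factorThru_comp]

end FinitelyGenerated

/-! ### Weakly Koszul functors form a Koszul class -/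

section WeaklyKoszul

variable {K : Type t} [Field K] {C : Type u} [Category.{v} C] [Preadditive C] [Linear K C]

/-- A weakly Koszul functor has a presentation by a finitely generated projective functor which is
compatible with the powers of the radical and which has a weakly Koszul syzygy. -/
lemma IsWeaklyKoszul.exists_presentation {F : FunctorMod.{v} K C} (hF : IsWeaklyKoszul F) :
    ∃ (Ω P : FunctorMod.{v} K C) (j : Ω ⟶ P) (p : P ⟶ F) (w : j ≫ p = 0),
      (ShortComplex.mk j p w).ShortExact ∧ (Projective P ∧ IsFinitelyGenerated P) ∧
      IsWeaklyKoszul Ω ∧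
      ∀ k, ∃ (a : ((radicalPreradical K C).pow (k + 1)).obj Ω ⟶
          ((radicalPreradical K C).pow (k + 2)).obj P)
        (hap : a ≫ ((radicalPreradical K C).pow (k + 2)).map p = 0),
        a ≫ (radicalPreradical K C).powι (k + 2) P = (radicalPreradical K C).powι (k + 1) Ω ≫ j ∧
          (ShortComplex.mk _ _ hap).Exact := by
  set ρ := radicalPreradical K C
  obtain ⟨P, d, ε, hP, hε, h₀, hd, hrad⟩ := hF
  have hsub : IsSubfunctor (P 0) (fun X => LinearMap.range (component (d 0) X)) := by
    rintro X Y f _ ⟨y, rfl⟩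
    exact ⟨action (P 1) f y, component_action (d 0) f y⟩
  let Ω := subfunctor hsub
  let j : Ω ⟶ P 0 := subfunctorι hsub
  have hj : ∀ X, LinearMap.range (component j X) = LinearMap.range (component (d 0) X) :=
    range_subfunctorι hsub
  have hjinj := component_subfunctorι_injective hsub
  have hexact : ∀ X, Function.Exact (component j X) (component ε X) := fun X x => by
    rw [h₀ X x]
    exact (SetLike.ext_iff.1 (hj X) x).symm
  have hw : j ≫ ε = 0 := functorMod_hom_ext fun X x => (hexact X _).2 ⟨x, rfl⟩
  obtain ⟨ε', hε'⟩ := exists_lift_of_range_le j (d 0) fun X => (hj X).ge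
  have hε'' : ∀ X y, component j X (component ε' X y) = component (d 0) X y := fun X y => by
    rw [← component_comp, hε']
  have hε0 : Epi ε := epi_of_surjective ε hε
  refine ⟨Ω, P 0, j, ε, hw, ⟨exact_of_component _ hexact⟩, hP 0, ?_, fun k => ?_⟩
  -- The truncated resolution witnesses that `Ω` is weakly Koszul.
  · refine ⟨fun n => P (n + 1), fun n => d (n + 1), ε', fun n => hP (n + 1), fun X x => ?_,
      fun X x => ?_, fun n => hd (n + 1), fun n => hrad (n + 1)⟩
    · obtain ⟨y, hy⟩ : component j X x ∈ LinearMap.range (component (d 0) X) := by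
        rw [← hj]
        exact ⟨x, rfl⟩
      exact ⟨y, hjinj X ((hε'' X y).trans hy)⟩
    · rw [← hd 0 X x, ← hε'']
      exact ((injective_iff_map_eq_zero' _).1 (hjinj X) _).symm
  · have hrange : ∀ X, LinearMap.range (component (ρ.powι (k + 1) Ω ≫ j) X) =
        LinearMap.range (component (ρ.powι (k + 2) (P 0)) X) ⊓
          LinearMap.range (component (d 0) X) := fun X => by
      have htop : IsSubfunctor (P 0) (fun _ => ⊤) := fun _ _ _ _ _ => trivial
      rw [component_comp', LinearMap.range_comp, range_powι, range_powι, map_radicalSpan_iterate]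
      -- The Koszul condition is only available for exponents at least one, hence the shift to `k +
      -- 1`.
      have h := hrad 0 (k + 1) (Nat.le_add_left 1 k) X
      rw [radicalSub_eq_iterate hsub, radicalSub_eq_iterate htop] at h
      rw [h]
      refine congrArg (fun V => (radicalSpan (P 0))^[k + 1] V X) (funext fun Y => ?_)
      rw [Submodule.map_top, hj]
    obtain ⟨a, ha⟩ := exists_lift_of_range_le (ρ.powι (k + 2) (P 0)) (ρ.powι (k + 1) Ω ≫ j)
      fun X => (hrange X).le.trans inf_le_left
    have hap : a ≫ (ρ.pow (k + 2)).map ε = 0 := by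
      rw [← cancel_mono (ρ.powι (k + 2) F), Category.assoc, ρ.map_powι, reassoc_of% ha, hw,
        comp_zero, zero_comp]
    refine ⟨a, hap, ha, exact_of_component _ fun X x => ⟨fun hx => ?_, ?_⟩⟩
    · have hmem : component (ρ.powι (k + 2) (P 0)) X x ∈
          LinearMap.range (component (ρ.powι (k + 1) Ω ≫ j) X) := by
        rw [hrange]
        refine ⟨⟨x, rfl⟩, (h₀ X _).1 ?_⟩
        rw [← component_comp, ← ρ.map_powι, component_comp]
        exact (congrArg _ hx).trans (map_zero _)
      obtain ⟨y, hy⟩ := hmem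
      refine ⟨y, component_injective (ρ.powι (k + 2) (P 0)) X ?_⟩
      rw [← hy, ← component_comp, ha]
    · rintro ⟨y, rfl⟩
      change component ((ρ.pow (k + 2)).map ε) X (component a X y) = 0
      rw [← component_comp, hap, component_zero]

lemma IsWeaklyKoszul.isFinitelyGenerated {F : FunctorMod.{v} K C} (hF : IsWeaklyKoszul F) :
    IsFinitelyGenerated F := by
  obtain ⟨P, d, ε, hP, hε, -⟩ := hF
  have := epi_of_surjective ε hε
  exact (hP 0).2.of_epi ε

namespace IsWeaklyKoszulCategory

variable [HasFiniteBiproducts C] (hC : IsWeaklyKoszulCategory K C)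

include hC

/-- It suffices to treat `Hom(-, Y)` with `End Y` local. Its top is weakly Koszul and so has a
finitely generated syzygy `Ω`, and its radical is a summand of `Ω ⊕ Hom(-, Y)`. -/
lemma isFinitelyGenerated_radical {G : FunctorMod.{v} K C} (hG : IsFinitelyGenerated G) :
    IsFinitelyGenerated ((radicalPreradical K C).functor.obj G) := by
  set ρ := radicalPreradical K C
  obtain ⟨X, q, _⟩ := hG
  have := ρ.epi_map q
  refine IsFinitelyGenerated.of_epi ?_ (ρ.functor.map q)
  obtain ⟨n, Y, p, s, hY, hps⟩ := exists_representable_decomposition (K := K) hC.krullSchmidt X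
  refine IsFinitelyGenerated.of_sum (fun i => ρ.functor.map (p i)) (fun i => ρ.functor.map (s i))
    ?_ fun i => ?_
  · simp only [← CategoryTheory.Functor.map_comp, ← Functor.map_sum, hps,
      CategoryTheory.Functor.map_id]
  · have := hY i
    obtain ⟨Ω, Q, j, q, hjq, hS, ⟨hQ, hQ'⟩, hΩ, -⟩ :=
      (hC.simple_isWeaklyKoszul _ (simple_top_representable (Y i))).exists_presentation
    obtain ⟨a, b, h, hab⟩ := EpiPreradical.exists_syzygy_decomposition hS
    exact IsFinitelyGenerated.of_add _ _ _ _ hab hΩ.isFinitelyGenerated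
      (IsFinitelyGenerated.representable _)

lemma isFinitelyGenerated_pow {G : FunctorMod.{v} K C} (hG : IsFinitelyGenerated G) (k : ℕ) :
    IsFinitelyGenerated (((radicalPreradical K C).pow k).obj G) := by
  induction k with
  | zero => exact hG
  | succ k ih => exact hC.isFinitelyGenerated_radical ih

lemma isKoszulClass : (radicalPreradical K C).IsKoszulClass
    (fun P => Projective P ∧ IsFinitelyGenerated P) IsWeaklyKoszul where
  projective P hP := hP.1
  splitsSubobjects P hP k := (isFiniteSumOfSimple_top hC.krullSchmidt
    (hC.isFinitelyGenerated_pow hP.2 (k + 1))).splitsSubobjects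
  decomposition P hP := by
    have := hP.1
    obtain ⟨n, Y, p, s, hY, hps⟩ := projective_decomposition hC.krullSchmidt hP.2
    refine ⟨n, fun i => representable K (Y i), p, s, hps, fun i =>
      ⟨⟨inferInstance, IsFinitelyGenerated.representable _⟩, ?_⟩⟩
    have := hY i
    exact hC.simple_isWeaklyKoszul _ (simple_top_representable (Y i))
  presentation F hF := hF.exists_presentation

end IsWeaklyKoszulCategory

end WeaklyKoszul

/-! ### Splicing the long exact sequences -/

section TotalExt

variable {A : Type u} [Category.{v} A] [Abelian A] [HasExt.{w} A]

lemma totalComp_of_apply {X Y Z : A} {a : ℕ} (α : Ext.{w} X Y a) (y : TotalExt Y Z) {b c : ℕ}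
    (h : a + b = c) : totalComp X Y Z (DirectSum.of _ a α) y c = α.comp (y b) h := by
  induction y using DirectSum.induction_on with
  | zero => rw [map_zero, DirectSum.zero_apply, DirectSum.zero_apply, Ext.comp_zero]
  | add y y' hy hy' =>
    rw [map_add, DirectSum.add_apply, hy, hy', DirectSum.add_apply, Ext.comp_add]
  | of n β =>
    rw [totalComp_of α β rfl]
    by_cases hn : n = b
    · subst hn
      subst h
      rw [DirectSum.of_eq_same, DirectSum.of_eq_same]
    · rw [DirectSum.of_eq_of_ne _ _ _ (by omega), DirectSum.of_eq_of_ne _ _ _ (Ne.symm hn),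
        Ext.comp_zero]

namespace EpiPreradical

variable (ρ : EpiPreradical A)

/-- The class in `Ext^1` of the extension of the top of `G` by the top of the radical of `G`. -/
noncomputable def topClass (G : A) : Ext.{w} (ρ.top G) (ρ.top (ρ.functor.obj G)) 1 :=
  (ρ.top_shortExact G).extClass.comp (Ext.mk₀ (ρ.topπ (ρ.functor.obj G))) (add_zero 1)

variable {ρ}

lemma exists_totalComp_topπ {G X : A} (h : ∀ n, ρ.ExtVanishes.{w} n G) (hX : ρ.ι X = 0)
    (x : TotalExt.{w} G X) : ∃ y, totalComp G (ρ.top G) X (totalMk (ρ.topπ G)) y = x := by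
  induction x using DirectSum.induction_on with
  | zero => exact ⟨0, map_zero _⟩
  | add x x' hx hx' =>
    obtain ⟨y, rfl⟩ := hx
    obtain ⟨y', rfl⟩ := hx'
    exact ⟨y + y', map_add _ _ _⟩
  | of n x =>
    obtain ⟨y, rfl⟩ := (h n).exists_top hX x
    exact ⟨DirectSum.of _ n y, totalComp_of _ _ (zero_add n)⟩

lemma totalComp_topπ_topClass (G : A) :
    totalComp G _ _ (totalMk (ρ.topπ G)) (DirectSum.of _ 1 (ρ.topClass.{w} G)) = 0 := by
  rw [totalMk, totalComp_of _ _ (zero_add 1), topClass, (ρ.top_shortExact G).comp_extClass_assoc,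
    map_zero]

/-- The kernel of `Ext^*(top G, X) → Ext^*(G, X)` is the image of the connecting map from `Ext^*(R
G, X)`; vanishing for `R G` lets each class there be lifted to `top(R G)`, which turns the
connecting map into a product with `topClass`. -/
lemma totalComp_topπ_eq_zero_iff {G X : A} (h : ∀ n, ρ.ExtVanishes.{w} n (ρ.functor.obj G))
    (hX : ρ.ι X = 0) (y : TotalExt.{w} (ρ.top G) X) :
    totalComp G (ρ.top G) X (totalMk (ρ.topπ G)) y = 0 ↔
      ∃ z, totalComp _ _ X (DirectSum.of _ 1 (ρ.topClass G)) z = y := by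
  constructor
  · intro hy
    have key : ∀ m : ℕ, ∃ z, totalComp _ _ X (DirectSum.of _ 1 (ρ.topClass G)) z =
        DirectSum.of (fun n => Ext.{w} (ρ.top G) X n) m (y m) := by
      intro m
      have hm : (Ext.mk₀ (ρ.topπ G)).comp (y m) (zero_add m) = 0 := by
        rw [← totalComp_of_apply (Ext.mk₀ (ρ.topπ G)) y (zero_add m)]
        exact congrArg (fun x => x m) hy
      cases m with
      | zero =>
        -- Degree zero receives no connecting map, but there precomposition with an epimorphism is
        -- injective.
        have : y 0 = 0 := Ext.precomp_mk₀_injective_of_epi X (ρ.topπ G)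
          (hm.trans (Ext.comp_zero _ X 0 0 (zero_add 0)).symm)
        rw [this, map_zero]
        exact ⟨0, map_zero _⟩
      | succ m =>
        obtain ⟨x, hx⟩ := Ext.contravariant_sequence_exact₃ (ρ.top_shortExact G) X (y (m + 1)) hm
          (add_comm 1 m)
        obtain ⟨z, rfl⟩ := (h m).exists_top hX x
        refine ⟨DirectSum.of _ m z, ?_⟩
        rw [totalComp_of _ _ (add_comm 1 m), ← hx, topClass, Ext.comp_assoc_of_second_deg_zero]
    choose z hz using key
    classical
    refine ⟨∑ m ∈ DFinsupp.support y, z m, ?_⟩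
    rw [map_sum]
    simp only [hz]
    exact DirectSum.sum_support_of y
  · rintro ⟨z, rfl⟩
    rw [← totalComp_assoc, totalComp_topπ_topClass, map_zero, AddMonoidHom.zero_apply]

/-- Vanishing for `G` makes the connecting map `Ext^m(R G, X) → Ext^(m+1)(top G, X)` injective, so
only the projection factor of `topClass` can kill `y`. -/
lemma totalComp_topClass_eq_zero_iff {G X : A} (h : ∀ n, ρ.ExtVanishes.{w} n G)
    (hX : ρ.ι X = 0) (y : TotalExt.{w} (ρ.top (ρ.functor.obj G)) X) :
    totalComp _ _ X (DirectSum.of _ 1 (ρ.topClass G)) y = 0 ↔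
      totalComp _ _ X (totalMk (ρ.topπ (ρ.functor.obj G))) y = 0 := by
  constructor
  · intro hy
    refine DFinsupp.ext fun m => ?_
    refine (totalComp_of_apply (Ext.mk₀ (ρ.topπ (ρ.functor.obj G))) y (zero_add m)).trans ?_
    have hm : (ρ.top_shortExact G).extClass.comp
        ((Ext.mk₀ (ρ.topπ (ρ.functor.obj G))).comp (y m) (zero_add m)) rfl = 0 := by
      rw [← Ext.comp_assoc_of_second_deg_zero]
      change (ρ.topClass G).comp (y m) rfl = 0
      rw [← totalComp_of_apply (ρ.topClass G) y rfl]
      exact congrArg (fun x => x (1 + m)) hy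
    obtain ⟨x, hx⟩ := Ext.contravariant_sequence_exact₁ (ρ.top_shortExact G) X _ rfl hm
    rw [← hx]
    exact h m X hX x
  · intro hy
    have : DirectSum.of (fun n => Ext.{w} (ρ.top G) (ρ.top (ρ.functor.obj G)) n) 1 (ρ.topClass G) =
        totalComp _ _ _ (DirectSum.of _ 1 (ρ.top_shortExact G).extClass)
          (totalMk (ρ.topπ (ρ.functor.obj G))) := by
      rw [totalMk, totalComp_of _ _ (add_zero 1), topClass]
    rw [this, totalComp_assoc]
    exact (congrArg _ hy).trans (map_zero _)

end EpiPreradical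

end TotalExt

/-! ### Structure of the Ext-category -/

namespace ExtCategory

variable {A : Type u} [Category.{v} A] [Abelian A] [HasExt.{w} A]

section

lemma totalMk_add {X Y : A} (f g : X ⟶ Y) : totalMk.{w} (f + g) = totalMk f + totalMk g := by
  rw [totalMk, Ext.mk₀_add, map_add]
  rfl

lemma totalMk_zero (X Y : A) : totalMk.{w} (0 : X ⟶ Y) = 0 := by
  rw [totalMk, Ext.mk₀_zero, map_zero]

lemma totalMk_sum {X Y : A} {J : Type*} (s : Finset J) (f : J → (X ⟶ Y)) :
    totalMk.{w} (∑ j ∈ s, f j) = ∑ j ∈ s, totalMk (f j) :=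
  map_sum (AddMonoidHom.mk' (totalMk.{w} (X := X) (Y := Y)) totalMk_add) f s

lemma totalMk_injective {X Y : A} : Function.Injective (totalMk.{w} (X := X) (Y := Y)) :=
  fun _ _ h => (Ext.mk₀_bijective _ _).1 (DirectSum.of_injective _ h)

end

variable {P : ObjectProperty A}

/-- The morphism of degree zero of the `Ext`-category given by a morphism of `A`. -/
noncomputable def ofHom {X Y : ExtCategory P} (f : X.obj ⟶ Y.obj) : X ⟶ Y := totalMk.{w} f

lemma ofHom_comp {X Y Z : ExtCategory P} (f : X.obj ⟶ Y.obj) (g : Y.obj ⟶ Z.obj) :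
    (ofHom (f ≫ g) : X ⟶ Z) = ofHom f ≫ ofHom g := totalMk_comp f g

lemma ofHom_zero (X Y : ExtCategory P) : (ofHom 0 : X ⟶ Y) = 0 := totalMk_zero _ _

lemma ofHom_add {X Y : ExtCategory P} (f g : X.obj ⟶ Y.obj) :
    (ofHom (f + g) : X ⟶ Y) = ofHom f + ofHom g := totalMk_add f g

lemma ofHom_sum {X Y : ExtCategory P} {J : Type*} (s : Finset J) (f : J → (X.obj ⟶ Y.obj)) :
    (ofHom (∑ j ∈ s, f j) : X ⟶ Y) = ∑ j ∈ s, ofHom (f j) := totalMk_sum s f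

lemma hasFiniteBiproducts [HasFiniteBiproducts A]
    (hP : ∀ (n : ℕ) (F : Fin n → A), (∀ i, P (F i)) → P (⨁ F)) :
    HasFiniteBiproducts (ExtCategory P) where
  out n :=
    { has_biproduct := fun F => by
        let S : Fin n → A := fun i => (F i).obj
        let b : Bicone F :=
          { pt := ⟨⨁ S, hP n S fun i => (F i).property⟩
            π := fun j => ofHom (biproduct.π S j)
            ι := fun j => ofHom (biproduct.ι S j)
            ι_π := fun j j' => by
              rw [← ofHom_comp]
              split_ifs with h
              · subst h
                rw [biproduct.ι_π_self]
                rfl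
              · rw [biproduct.ι_π_ne _ h, ofHom_zero] }
        refine hasBiproduct_of_total b ?_
        have : ∑ j, b.π j ≫ b.ι j = ofHom (∑ j, biproduct.π S j ≫ biproduct.ι S j) := by
          rw [ofHom_sum]
          exact Finset.sum_congr rfl fun j _ => (ofHom_comp _ _).symm
        rw [this, biproduct.total]
        rfl }

variable {K : Type t} [Field K] [Linear K A]

lemma ofHom_mem_homDeg {X Y : ExtCategory P} (f : X.obj ⟶ Y.obj) :
    ofHom f ∈ GradedCategory.homDeg (K := K) X Y 0 :=
  of_mem_natDeg K (fun n => Ext.{w} X.obj Y.obj n) 0 (Ext.mk₀ f)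

lemma exists_ofHom {X Y : ExtCategory P} {a : X ⟶ Y}
    (ha : a ∈ GradedCategory.homDeg (K := K) X Y 0) : ∃ f : X.obj ⟶ Y.obj, a = ofHom f := by
  obtain h | ⟨n, y, hn, h⟩ := exists_of_mem_natDeg K (fun n => Ext.{w} X.obj Y.obj n) ha
  · exact ⟨0, h.trans (ofHom_zero X Y).symm⟩
  · obtain rfl : n = 0 := by exact_mod_cast hn
    obtain ⟨f, rfl⟩ := (Ext.mk₀_bijective _ _).2 y
    exact ⟨f, h⟩

lemma isPositivelyGraded : IsPositivelyGraded K (ExtCategory P)ᵒᵖ := by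
  intro X Y i hi
  rw [eq_bot_iff]
  rintro _ ⟨x, hx, rfl⟩
  have : x = 0 := DFinsupp.ext fun n => hx n (by omega)
  rw [this]
  exact map_zero _

/-- Schur's lemma: the degree zero endomorphisms are those of a simple object, and of two with sum
the identity at least one is nonzero. -/
lemma hasGradedLocalEnd (X : ExtCategory P) [Simple X.obj] : HasGradedLocalEnd K (op X) := by
  refine ⟨fun h => ?_, ?_⟩
  · have h₁ : ofHom (𝟙 X.obj) = (ofHom 0 : X ⟶ X) :=
      (congrArg Quiver.Hom.unop h).trans (ofHom_zero X X).symm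
    exact id_nonzero X.obj (totalMk_injective h₁)
  · rintro _ _ ⟨a, ha, rfl⟩ ⟨b, hb, rfl⟩ hab
    obtain ⟨f, rfl⟩ := exists_ofHom (K := K) ha
    obtain ⟨g, rfl⟩ := exists_ofHom (K := K) hb
    have h₁ : (ofHom (f + g) : X ⟶ X) = ofHom (𝟙 X.obj) :=
      (ofHom_add f g).trans (congrArg Quiver.Hom.unop hab)
    have h₂ : f + g = 𝟙 X.obj := totalMk_injective h₁
    have key : ∀ f : X.obj ⟶ X.obj, f ≠ 0 →
        IsIso (opLinearEquiv K (ExtCategory P) X X (ofHom f)) := by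
      intro f hf
      have := isIso_of_hom_simple hf
      have : IsIso (ofHom f : X ⟶ X) :=
        ⟨ofHom (inv f), by rw [← ofHom_comp, IsIso.hom_inv_id]; rfl,
          by rw [← ofHom_comp, IsIso.inv_hom_id]; rfl⟩
      exact inferInstanceAs (IsIso (ofHom f : X ⟶ X).op)
    by_cases hf : f = 0
    · refine Or.inr (key g fun hg => id_nonzero X.obj ?_)
      rw [← h₂, hf, hg, add_zero]
    · exact Or.inl (key f hf)

lemma isGradedKrullSchmidt [HasFiniteBiproducts A] (hP : P = fun F => IsFiniteSumOfSimple F) :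
    IsGradedKrullSchmidt K (ExtCategory P)ᵒᵖ := by
  subst hP
  intro X
  obtain ⟨n, S, hS, ⟨e⟩⟩ := X.unop.property
  let Y : Fin n → ExtCategory (fun F : A => IsFiniteSumOfSimple F) := fun i =>
    ⟨S i, have := hS i; IsFiniteSumOfSimple.of_simple (S i)⟩
  let a : ∀ i, X.unop ⟶ Y i := fun i => ofHom (e.hom ≫ biproduct.π S i)
  let b : ∀ i, Y i ⟶ X.unop := fun i => ofHom (biproduct.ι S i ≫ e.inv)
  refine ⟨n, fun i => op (Y i), fun i => (a i).op, fun i => (b i).op, fun i => ?_, fun i => ?_,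
    fun i => ?_, fun i => ?_, fun i j hij => ?_, ?_⟩
  · have : Simple (Y i).obj := hS i
    exact hasGradedLocalEnd (Y i)
  · exact ⟨a i, ofHom_mem_homDeg (K := K) _, rfl⟩
  · exact ⟨b i, ofHom_mem_homDeg (K := K) _, rfl⟩
  · refine Quiver.Hom.unop_inj ((ofHom_comp (X := Y i) (Y := X.unop) (Z := Y i) _ _).symm.trans ?_)
    rw [Category.assoc, e.inv_hom_id_assoc, biproduct.ι_π_self]
    rfl
  · refine Quiver.Hom.unop_inj ((ofHom_comp (X := Y j) (Y := X.unop) (Z := Y i) _ _).symm.trans ?_)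
    rw [Category.assoc, e.inv_hom_id_assoc, biproduct.ι_π_ne _ hij.symm, ofHom_zero]
    rfl
  · have h₁ : ∑ i, (b i).op ≫ (a i).op = (∑ i, a i ≫ b i).op := by
      rw [op_sum]
      rfl
    have h₂ : ∑ i, a i ≫ b i =
        ofHom (e.hom ≫ (∑ i, biproduct.π S i ≫ biproduct.ι S i) ≫ e.inv) := by
      rw [Preadditive.sum_comp, Preadditive.comp_sum, ofHom_sum]
      refine Finset.sum_congr rfl fun i _ => ?_
      rw [← ofHom_comp]
      simp only [Category.assoc]
    rw [h₁, h₂, biproduct.total, Category.id_comp, e.hom_inv_id]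
    rfl

lemma isLocallyFinite (hP : ∀ X Y : A, P X → P Y → ∀ n, Module.Finite K (Ext.{w} X Y n)) :
    IsLocallyFinite K (ExtCategory P)ᵒᵖ := by
  intro X Y i
  have key : Module.Finite K (natDeg K (fun n => Ext.{w} Y.unop.obj X.unop.obj n) i) := by
    by_cases hi : ∃ n : ℕ, (n : ℤ) = i
    · obtain ⟨n, rfl⟩ := hi
      have := hP Y.unop.obj X.unop.obj Y.unop.property X.unop.property n
      let f : Ext.{w} Y.unop.obj X.unop.obj n →ₗ[K]
          natDeg K (fun n => Ext.{w} Y.unop.obj X.unop.obj n) (n : ℤ) :=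
        (DirectSum.lof K ℕ (fun n => Ext.{w} Y.unop.obj X.unop.obj n) n).codRestrict _
          (fun x => of_mem_natDeg K _ n x)
      refine Module.Finite.of_surjective f ?_
      rintro ⟨x, hx⟩
      obtain rfl | ⟨m, y, hm, rfl⟩ := exists_of_mem_natDeg K _ hx
      · exact ⟨0, map_zero f⟩
      · obtain rfl : m = n := by exact_mod_cast hm
        exact ⟨y, rfl⟩
    · have : natDeg K (fun n => Ext.{w} Y.unop.obj X.unop.obj n) i = ⊥ := by
        rw [eq_bot_iff]
        intro x hx
        exact DFinsupp.ext fun n => hx n fun hn => hi ⟨n, hn⟩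
      rw [this]
      infer_instance
  exact Module.Finite.map _ _

end ExtCategory

/-! ### Finite dimensionality of Ext between semisimple functors -/

section LocalFiniteness

variable {K : Type t} [Field K]

section

variable {A : Type u} [Category.{v} A] [Abelian A] [HasExt.{w} A] [Linear K A]

variable (K) in
/-- The left multiplication by a class, as a linear map on `Ext`. -/
noncomputable def extPrecomp {X Y : A} {a : ℕ} (α : Ext.{w} X Y a) (Z : A) {b c : ℕ}
    (h : a + b = c) : Ext.{w} Y Z b →ₗ[K] Ext.{w} X Z c where
  toFun y := α.comp y h
  map_add' y y' := Ext.comp_add α y y' h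
  map_smul' r y := Ext.comp_smul α y h r

end

variable {C : Type u} [Category.{v} C] [Preadditive C] [Linear K C]

/-- `S` is a quotient of some `Hom(-, W)`, and radical morphisms act as zero on it, so `S(X)` is a
quotient of `Hom(X, W)/rad(X, W)`. -/
lemma finite_value_of_simple (hC : IsLocallyRadicalFinite K C) (S : FunctorMod.{v} K C) [Simple S]
    (X : C) : Module.Finite K (S.obj.obj (op X)) := by
  obtain ⟨W, s, hs⟩ := exists_ne_zero_of_simple S
  have : Epi (ofElement S s) := epi_of_nonzero_to_simple (ofElement_ne_zero hs)
  have hrad : ∀ {f : X ⟶ W}, f ∈ radical K X W → action S f s = 0 := by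
    intro f hf
    have h := action_mem_radicalSpan (F := S) (U := fun _ => ⊤) hf (y := s) trivial
    rw [← range_radicalι, radicalι_of_simple S] at h
    obtain ⟨y, hy⟩ := h
    exact hy.symm
  let f : radicalPow K 0 X W →ₗ[K] S.obj.obj (op X) :=
    { toFun := fun f => action S f.1 s
      map_add' := fun f g => action_add f.1 g.1 s
      map_smul' := fun r f => action_smul r f.1 s }
  have hker : (radicalPow K 1 X W).submoduleOf (radicalPow K 0 X W) ≤ LinearMap.ker f := by
    have hle : radicalPow K 1 X W ≤ radical K X W := by
      refine Submodule.span_le.2 ?_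
      rintro _ ⟨B, g, h, -, hh, rfl⟩
      exact comp_mem_radical g hh
    intro g hg
    exact hrad (hle hg)
  have := hC X W 0
  refine Module.Finite.of_surjective (Submodule.liftQ _ f hker) fun x => ?_
  obtain ⟨g, rfl⟩ := component_surjective (ofElement S s) X x
  exact ⟨Submodule.Quotient.mk ⟨g, trivial⟩, rfl⟩

lemma finite_value (hC : IsLocallyRadicalFinite K C) {T : FunctorMod.{v} K C}
    (hT : IsFiniteSumOfSimple T) (X : C) : Module.Finite K (T.obj.obj (op X)) := by
  refine hT.induction (p := fun T => Module.Finite K (T.obj.obj (op X))) (fun Z hZ => ?_)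
    (fun S σ _ h₁ => ?_)
  · have : Subsingleton (Z.obj.obj (op X)) := by
      refine ⟨fun x y => ?_⟩
      rw [← component_id X x, ← component_id X y, hZ.eq_of_src (𝟙 Z) 0]
      rfl
    infer_instance
  · have h₃ := finite_value_of_simple hC S.X₃ X
    refine Module.Finite.of_injective ((component σ.r X).prod (component S.g X)) ?_
    rw [injective_iff_map_eq_zero]
    intro x hx
    obtain ⟨hr, hg⟩ := Prod.mk.inj hx
    have h := congrArg (fun η => component η X x) σ.id
    refine h.symm.trans ?_
    change component S.f X (component σ.r X x) + component σ.s X (component S.g X x) = 0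
    rw [hr, hg, map_zero, map_zero, add_zero]

variable [HasExt.{w} (FunctorMod.{v} K C)]

/-- Evaluation at a generator embeds `Hom(F, T)` in some `T(X)`; higher degrees are quotients of Ext
groups of the syzygy, which is again weakly Koszul. -/
lemma IsWeaklyKoszul.finite_ext (hC : IsLocallyRadicalFinite K C) {F T : FunctorMod.{v} K C}
    (hF : IsWeaklyKoszul F) (hT : IsFiniteSumOfSimple T) (n : ℕ) :
    Module.Finite K (Ext.{w} F T n) := by
  induction n generalizing F with
  | zero =>
    obtain ⟨X, p, _⟩ := hF.isFinitelyGenerated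
    have := finite_value hC hT X
    let f : (F ⟶ T) →ₗ[K] T.obj.obj (op X) :=
      { toFun := fun η => value (p ≫ η) (𝟙 X)
        map_add' := fun η θ => rfl
        map_smul' := fun r η => rfl }
    refine Module.Finite.of_injective (f ∘ₗ (Ext.linearEquiv₀ (R := K)).toLinearMap) ?_
    refine Function.Injective.comp (g := f) ?_ (Ext.linearEquiv₀ (R := K)).injective
    intro η θ h
    rw [← cancel_epi p, hom_eq_ofElement (p ≫ η), hom_eq_ofElement (p ≫ θ)]
    exact congrArg (ofElement T) h
  | succ n ih =>
    obtain ⟨Ω, P, j, p, w, hS, ⟨_, -⟩, hΩ, -⟩ := hF.exists_presentation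
    have := ih hΩ
    refine Module.Finite.of_surjective (extPrecomp K hS.extClass T (add_comm 1 n)) fun x => ?_
    exact Ext.contravariant_sequence_exact₃ hS T x (Ext.eq_zero_of_projective _) (add_comm 1 n)

lemma IsWeaklyKoszulCategory.finite_ext [HasFiniteBiproducts C] (hC : IsWeaklyKoszulCategory K C)
    {F T : FunctorMod.{v} K C} (hF : IsFiniteSumOfSimple F) (hT : IsFiniteSumOfSimple T) (n : ℕ) :
    Module.Finite K (Ext.{w} F T n) := by
  refine hF.induction (p := fun F => Module.Finite K (Ext.{w} F T n)) (fun Z hZ => ?_)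
    (fun S σ h₃ h₁ => ?_)
  · have : Subsingleton (Ext.{w} Z T n) := by
      refine ⟨fun x y => ?_⟩
      rw [← Ext.mk₀_id_comp x, ← Ext.mk₀_id_comp y, hZ.eq_of_src (𝟙 Z) 0, Ext.mk₀_zero,
        Ext.zero_comp, Ext.zero_comp]
    infer_instance
  · have := (hC.simple_isWeaklyKoszul S.X₃ h₃).finite_ext hC.locallyRadicalFinite hT n
    refine Module.Finite.of_injective ((extPrecomp K (Ext.mk₀ S.f) T (zero_add n)).prod
      (extPrecomp K (Ext.mk₀ σ.s) T (zero_add n))) ?_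
    rw [injective_iff_map_eq_zero]
    intro x hx
    obtain ⟨hf, hs⟩ := Prod.mk.inj hx
    replace hf : (Ext.mk₀ S.f).comp x (zero_add n) = 0 := hf
    replace hs : (Ext.mk₀ σ.s).comp x (zero_add n) = 0 := hs
    rw [← Ext.mk₀_id_comp x, ← σ.id, Ext.mk₀_add, Ext.add_comp, ← Ext.mk₀_comp_mk₀_assoc,
      ← Ext.mk₀_comp_mk₀_assoc, hf, hs, Ext.comp_zero, Ext.comp_zero, add_zero]

end LocalFiniteness

/-! ### Linear resolutions of `Ext^*(F, -)` -/

section Linearity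

variable {K : Type t} [Field K]

namespace GradedFunctor

variable {D : Type u} [Category.{v} D] [Preadditive D] [Linear K D] [GradedCategory K D]

lemma representableMap_mem_homDeg {X Y : D} {f : X ⟶ Y}
    (hf : f ∈ GradedCategory.homDeg (K := K) X Y 1) (n : ℕ) :
    representableMap K f ∈ homDeg ((representable K X).shift (-((n + 1 : ℕ) : ℤ)))
      ((representable K Y).shift (-(n : ℤ))) 0 := by
  intro Z j g hg
  have h := GradedCategory.comp_mem (K := K) (D := D) hg hf
  -- The degree one of `f` absorbs the difference between the shifts by `-(n + 1)` and `-n`, leaving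
  -- a map of degree zero.
  have hij : -((n + 1 : ℕ) : ℤ) + j + 1 = -(n : ℤ) + (0 + j) := by
    push_cast
    ring
  rw [hij] at h
  exact h

lemma ofElement_mem_homDeg {F : GradedFunctor.{v} K D} {X : D} {x : F.toFunctorMod.obj.obj (op X)}
    (hx : x ∈ F.deg X 0) : ofElement F.toFunctorMod x ∈ homDeg (representable K X) F 0 := by
  intro Z j g hg
  have h := F.action_mem hg hx
  rw [add_comm j 0] at h
  exact h

lemma isLinear_of_exact {F : GradedFunctor.{v} K D} {P : ℕ → D} (d : ∀ n, P (n + 1) ⟶ P n)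
    (hd : ∀ n, d n ∈ GradedCategory.homDeg (K := K) (P (n + 1)) (P n) 1)
    {x : F.toFunctorMod.obj.obj (op (P 0))} (hx : x ∈ F.deg (P 0) 0)
    (h : ∀ X : D, Function.Surjective (component (ofElement F.toFunctorMod x) X))
    (h₀ : ∀ (X : D) (y : X ⟶ P 0), component (ofElement F.toFunctorMod x) X y = 0 ↔
      ∃ z : X ⟶ P 1, z ≫ d 0 = y)
    (h₁ : ∀ (n : ℕ) (X : D) (y : X ⟶ P (n + 1)), y ≫ d n = 0 ↔
      ∃ z : X ⟶ P (n + 2), z ≫ d (n + 1) = y) : F.IsLinear :=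
  ⟨P, fun n => representableMap K (d n), ofElement F.toFunctorMod x,
    fun n => representableMap_mem_homDeg (hd n) n, ofElement_mem_homDeg hx, h, h₀, h₁⟩

end GradedFunctor

section

variable {A : Type u} [Category.{v} A] [Abelian A] [HasExt.{w} A] [Linear K A]
  {P : ObjectProperty A} {ρ : EpiPreradical A} {F : A}

/-- The tops of the powers of a preradical on `F`, as objects of the `Ext`-category. -/
noncomputable def layer (hT : ∀ n, P (ρ.top ((ρ.pow n).obj F))) (n : ℕ) : ExtCategory P :=
  ⟨ρ.top ((ρ.pow n).obj F), hT n⟩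

/-- The morphism of degree one between consecutive layers. -/
noncomputable def layerHom (hT : ∀ n, P (ρ.top ((ρ.pow n).obj F))) (n : ℕ) :
    layer hT n ⟶ layer hT (n + 1) :=
  (DirectSum.of (fun m => Ext.{w} (ρ.top ((ρ.pow n).obj F)) (ρ.top ((ρ.pow (n + 1)).obj F)) m) 1
    (ρ.topClass ((ρ.pow n).obj F)) : TotalExt _ _)

/-- The morphism of degree zero from the first layer. -/
noncomputable def layerElement (hT : ∀ n, P (ρ.top ((ρ.pow n).obj F))) :
    TotalExt.{w} F (layer hT 0).obj :=
  totalMk (ρ.topπ F)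

/-- The splice: the vanishing on `R^n F` reduces the kernel to that of the projection from `R^(n+1)
F` onto its top, and the vanishing on `R^(n+2) F` identifies this with the multiples of the next
class. -/
lemma layerHom_comp_eq_zero_iff (hT : ∀ n, P (ρ.top ((ρ.pow n).obj F)))
    (hv : ∀ n k, ρ.ExtVanishes.{w} n ((ρ.pow k).obj F)) (hP : ∀ X, P X → ρ.ι X = 0) (n : ℕ)
    {X : ExtCategory P} (y : layer hT (n + 1) ⟶ X) :
    layerHom hT n ≫ y = 0 ↔ ∃ z : layer hT (n + 2) ⟶ X, layerHom hT (n + 1) ≫ z = y :=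
  (EpiPreradical.totalComp_topClass_eq_zero_iff (fun m => hv m n) (hP X.obj X.property) y).trans
    (EpiPreradical.totalComp_topπ_eq_zero_iff (fun m => hv m (n + 2)) (hP X.obj X.property) y)

lemma layerElement_comp_eq_zero_iff (hT : ∀ n, P (ρ.top ((ρ.pow n).obj F)))
    (hv : ∀ n k, ρ.ExtVanishes.{w} n ((ρ.pow k).obj F)) (hP : ∀ X, P X → ρ.ι X = 0)
    {X : ExtCategory P} (y : layer hT 0 ⟶ X) :
    totalComp F (layer hT 0).obj X.obj (layerElement hT) y = 0 ↔
      ∃ z : layer hT 1 ⟶ X, layerHom hT 0 ≫ z = y :=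
  EpiPreradical.totalComp_topπ_eq_zero_iff (fun m => hv m 1) (hP X.obj X.property) y

lemma exists_layerElement_comp (hT : ∀ n, P (ρ.top ((ρ.pow n).obj F)))
    (hv : ∀ n k, ρ.ExtVanishes.{w} n ((ρ.pow k).obj F)) (hP : ∀ X, P X → ρ.ι X = 0)
    {X : ExtCategory P} (x : TotalExt.{w} F X.obj) :
    ∃ y : layer hT 0 ⟶ X, totalComp F (layer hT 0).obj X.obj (layerElement hT) y = x :=
  EpiPreradical.exists_totalComp_topπ (fun m => hv m 0) (hP X.obj X.property) x

lemma layerHom_mem_natDeg (hT : ∀ n, P (ρ.top ((ρ.pow n).obj F))) (n : ℕ) :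
    layerHom.{w} hT n ∈
      natDeg K (fun m => Ext.{w} (layer hT n).obj (layer hT (n + 1)).obj m) ((1 : ℕ) : ℤ) :=
  of_mem_natDeg K (fun m => Ext.{w} (ρ.top ((ρ.pow n).obj F)) (ρ.top ((ρ.pow (n + 1)).obj F)) m)
    1 _

lemma layerHom_mem_homDeg (hT : ∀ n, P (ρ.top ((ρ.pow n).obj F))) (n : ℕ) :
    (layerHom.{w} hT n).op ∈
      GradedCategory.homDeg (K := K) (op (layer hT (n + 1))) (op (layer hT n)) 1 :=
  ⟨layerHom hT n, layerHom_mem_natDeg hT n, rfl⟩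

lemma layerElement_mem_natDeg (hT : ∀ n, P (ρ.top ((ρ.pow n).obj F))) :
    layerElement.{w} hT ∈ natDeg K (fun m => Ext.{w} F (layer hT 0).obj m) ((0 : ℕ) : ℤ) :=
  of_mem_natDeg K _ 0 _

/-- If the restrictions from all the powers `Rᵏ F` to `Rᵏ⁺¹ F` vanish on `Ext`, then the graded
functor `Ext^*(F, -)` is linear. -/
lemma isLinear_extGradedFunctor (hT : ∀ n, P (ρ.top ((ρ.pow n).obj F)))
    (hv : ∀ n k, ρ.ExtVanishes.{w} n ((ρ.pow k).obj F)) (hP : ∀ X, P X → ρ.ι X = 0) :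
    (ExtCategory.extGradedFunctor.{w} P K F).IsLinear := by
  refine GradedFunctor.isLinear_of_exact (P := fun n => op (layer hT n))
    (fun n => (layerHom hT n).op) (layerHom_mem_homDeg hT) (x := layerElement hT)
    (layerElement_mem_natDeg hT) (fun X x => ?_) (fun X x => ?_) (fun n X x => ?_)
  · obtain ⟨y, hy⟩ := exists_layerElement_comp hT hv hP (X := X.unop) x
    exact ⟨y.op, hy⟩
  · exact (layerElement_comp_eq_zero_iff hT hv hP x.unop).trans
      ⟨fun ⟨z, hz⟩ => ⟨z.op, Quiver.Hom.unop_inj hz⟩,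
        fun ⟨z, hz⟩ => ⟨z.unop, congrArg Quiver.Hom.unop hz⟩⟩
  · have h : x ≫ (layerHom hT n).op = 0 ↔ layerHom hT n ≫ x.unop = 0 :=
      ⟨fun h => congrArg Quiver.Hom.unop h, fun h => Quiver.Hom.unop_inj h⟩
    exact h.trans ((layerHom_comp_eq_zero_iff hT hv hP n x.unop).trans
      ⟨fun ⟨z, hz⟩ => ⟨z.op, Quiver.Hom.unop_inj hz⟩,
        fun ⟨z, hz⟩ => ⟨z.unop, congrArg Quiver.Hom.unop hz⟩⟩)

end

variable {C : Type u} [Category.{v} C] [Preadditive C] [Linear K C] [HasFiniteBiproducts C]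
  [HasExt.{w} (FunctorMod.{v} K C)]

lemma IsWeaklyKoszulCategory.isLinear (hC : IsWeaklyKoszulCategory K C) {F : FunctorMod.{v} K C}
    (hF : IsWeaklyKoszul F) :
    (ExtCategory.extGradedFunctor.{w} (isFiniteSumOfSimples K C) K F).IsLinear :=
  isLinear_extGradedFunctor (ρ := radicalPreradical K C)
    (fun n => isFiniteSumOfSimple_top hC.krullSchmidt
      (hC.isFinitelyGenerated_pow hF.isFinitelyGenerated n))
    (fun n k => hC.isKoszulClass.extVanishes n k hF)
    (fun _ hX => radicalι_of_isFiniteSumOfSimple hX)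

end Linearity

end KoszulCat

/-! ### The main theorem -/

theorem mainTheorem10 {K : Type t} [Field K] {C : Type u} [Category.{v} C] [Preadditive C]
    [Linear K C] [HasFiniteBiproducts C] [HasExt.{w} (KoszulCat.FunctorMod.{v} K C)]
    (hC : KoszulCat.IsWeaklyKoszulCategory K C) :
    (HasFiniteBiproducts (KoszulCat.KoszulDual K C)ᵒᵖ ∧
      KoszulCat.IsPositivelyGraded K (KoszulCat.KoszulDual K C)ᵒᵖ ∧
      KoszulCat.IsGradedKrullSchmidt K (KoszulCat.KoszulDual K C)ᵒᵖ ∧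
      KoszulCat.IsLocallyFinite K (KoszulCat.KoszulDual K C)ᵒᵖ) ∧
    ∃ Ψ : (KoszulCat.weaklyKoszulFunctors K C).FullSubcategoryᵒᵖ ⥤
        (KoszulCat.linearFunctors K (KoszulCat.KoszulDual K C)ᵒᵖ).FullSubcategory,
      Ψ ⋙ (KoszulCat.linearFunctors K (KoszulCat.KoszulDual K C)ᵒᵖ).ι =
        (KoszulCat.weaklyKoszulFunctors K C).ι.op ⋙ KoszulCat.koszulFunctor K C := by
  refine ⟨⟨?_, KoszulCat.ExtCategory.isPositivelyGraded,
    KoszulCat.ExtCategory.isGradedKrullSchmidt rfl,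
    KoszulCat.ExtCategory.isLocallyFinite fun X Y hX hY n => hC.finite_ext hX hY n⟩,
    -- Linear functors form a full subcategory, so linearity of the values on objects is all that
    -- the restriction requires.
    ObjectProperty.lift _ ((KoszulCat.weaklyKoszulFunctors K C).ι.op ⋙ KoszulCat.koszulFunctor K C)
      fun F => hC.isLinear F.unop.property, rfl⟩
  have : HasFiniteBiproducts (KoszulCat.KoszulDual K C) :=
    KoszulCat.ExtCategory.hasFiniteBiproducts fun n F hF =>
      KoszulCat.IsFiniteSumOfSimple.biproduct F hF
  exact HasFiniteBiproducts.of_hasFiniteProducts
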